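/- Let $\mathcal X$ be a metric space with its Borel $\sigma$-algebra and let $\rho$ be a probability measure on $\mathcal X\times\mathbb R$, the law of $(X,Y)$, whose marginal $\rho_X$ on $\mathcal X$ is concentrated on a separable subset of $\mathcal X$ (automatic if $\mathcal X$ is separable). Consider the regression model $Y=f^*(X)+\epsilon$ with $\mathbf E(\epsilon\mid X)=0$ and let $M>0$. Assume that the model is *MEE admissible*: $f^*$ is measurable with $|f^*|\le M$; for each $x\in\mathcal X$ the noise $\epsilon$ has, given $X=x$, a probability density $p_{\epsilon|X=x}$ (jointly measurable in $x$ and its argument), and these densities are bounded by a constant independent of $x$; and the Rényi entropy $\mathscr R(f)=-\log\int_{\mathbb R}p_E(e)^2\,de$, where $p_E$ is the density of $E=Y-f(X)$, attains its minimum over all measurable $f:\mathcal X\to\mathbb R$. Let $\mathcal H$ be an *MEE admissible* hypothesis space: a set of continuous functions on $\mathcal X$ with $|f|\le M$ for all $f\in\mathcal H$, containing $f^*$ and some minimizer of $\mathscr R$, and such that $\log\mathcal N_2(\mathcal H,\varepsilon)\le c\,\varepsilon^{-s}$ for all $\varepsilon>0$, with some $c>0$ and $0<s<2$. Here $\mathcal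 N_2(\mathcal H,\varepsilon)$ is the supremum over $n\ge1$ and $x\in\mathcal X^n$ of the minimal number of balls of radius $\varepsilon$, for the metric $d_2(a,b)=(\frac1n\sum_i|a_i-b_i|^2)^{1/2}$ on $\mathbb R^n$, that cover $\{(f(x_i))_{i=1}^n: f\in\mathcal H\}$. Assume that $\rho$ belongs to the noise class $\mathcal P_2$: there is $\widetilde M>0$ such that for every $x\in\mathcal X$ the density $p_{\epsilon|X=x}$ is even and supported in $[-\widetilde M,\widetilde M]$. Let $G_h(t)=\frac1{\sqrt{2\pi}h}e^{-t^2/(2h^2)}$ and $$\mathcal E_h(f)=-\iint G_h\big((y-f(x))-(y'-f(x'))\big)\,d\rho(x,y)\,d\rho(x',y').$$ For a sample $\mathbf z=((x_i,y_i))_{i=1}^n$ drawn from $\rho^n$, $n\ge1$, let $f_{\mathbf z}$ be a minimizer over $f\in\mathcal H$ of the empirical Rényi entropy $-\log\big(\frac1{n^2}\sum_{i,j=1}^nG_h(e_i-e_j)\big)$, $e_i=y_i-f(x_i)$. Then for every fixed $h>h_{\rho,\mathcal H}:=4M+2\widetilde M$: 1. for every constant $b\in\mathbb R$, $f^*+b$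 minimizes $\mathcal E_h$ over all measurable functions $f:\mathcal X\to\mathbb R$; 2. with $\mathbf E_x$ the expectation under $\rho_X$, $f_{\mathbf z}+\mathbf E_x(f^*-f_{\mathbf z})$ converges to $f^*$ in probability as $n\to\infty$: for every $\varepsilon>0$, $\ \mathbf P\big(\|f_{\mathbf z}+\mathbf E_x(f^*-f_{\mathbf z})-f^*\|_{L^2_{\rho_X}}^2>\varepsilon\big)\to0$; 3. there is a constant $C>0$, independent of $n$, $\delta$ and the choice of the minimizers $f_{\mathbf z}$, such that for all $n\ge1$ and $0<\delta<1$, with probability at least $1-\delta$, $$\|f_{\mathbf z}+\mathbf E_x(f^*-f_{\mathbf z})-f^*\|_{L^2_{\rho_X}}^2\le C\sqrt{\log(2/\delta)}\;n^{-1/2}.$$ (If the events in 2 and 3 are not measurable, the probability of the unfavourable event is understood as an outer probability.) -/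

import Mathlib

open MeasureTheory ProbabilityTheory Filter Topology Set
open scoped NNReal ENNReal

noncomputable section

namespace MEE

variable {X : Type*}

/-- The Gaussian kernel `G_h(t) = exp (-t² / (2 h²)) / (√(2π) h)` with bandwidth `h`. -/
def gaussKernel (h t : ℝ) : ℝ :=
  1 / (√(2 * Real.pi) * h) * Real.exp (-(t ^ 2 / (2 * h ^ 2)))

/-- The Rényi entropy of order 2 of the error variable `E = Y - f(X)`, that is
`-log ∫ p_E(e)² de`, where `p_E` is the Lebesgue density of `E` and `(X, Y)` has law `ρ`. -/
def renyiEntropy [MeasurableSpace X] (ρ : Measure (X × ℝ)) (f : X → ℝ) : ℝ :=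
  -Real.log (∫ e : ℝ, (pdf (fun z : X × ℝ => z.2 - f z.1) ρ volume e).toReal ^ 2)

/-- `f` is a measurable function that minimizes the Rényi entropy over all measurable functions. -/
def IsRenyiMinimizer [MeasurableSpace X] (ρ : Measure (X × ℝ)) (f : X → ℝ) : Prop :=
  Measurable f ∧ ∀ g : X → ℝ, Measurable g → renyiEntropy ρ f ≤ renyiEntropy ρ g

/-- The empirical Rényi entropy of `f` on a sample `z` of size `n`, obtained by plugging in the
kernel density estimator with bandwidth `h`: with `e_i = y_i - f(x_i)` it is
`-log (n⁻² ∑_{i,j} G_h(e_i - e_j))`. -/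
def empiricalRenyi (h : ℝ) {n : ℕ} (z : Fin n → X × ℝ) (f : X → ℝ) : ℝ :=
  -Real.log (1 / (n : ℝ) ^ 2 * ∑ i : Fin n, ∑ j : Fin n,
    gaussKernel h (((z i).2 - f (z i).1) - ((z j).2 - f (z j).1)))

/-- `f` is an output of the MEE algorithm with bandwidth `h` over the hypothesis space `H` on the
sample `z`: it minimizes the empirical Rényi entropy over `H`. -/
def IsMEEOutput (H : Set (X → ℝ)) (h : ℝ) {n : ℕ} (z : Fin n → X × ℝ) (f : X → ℝ) : Prop :=
  f ∈ H ∧ ∀ g ∈ H, empiricalRenyi h z f ≤ empiricalRenyi h z g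

/-- The information error
`E_h(f) = -∫∫ G_h((y - f(x)) - (y' - f(x'))) dρ(x, y) dρ(x', y')`. -/
def informationError [MeasurableSpace X] (ρ : Measure (X × ℝ)) (h : ℝ) (f : X → ℝ) : ℝ :=
  -∫ z : X × ℝ, ∫ z' : X × ℝ,
    gaussKernel h ((z.2 - f z.1) - (z'.2 - f z'.1)) ∂ρ ∂ρ

/-- `‖f + E_x(f* - f) - f*‖²` in `L²(μ)`, where `E_x` is the expectation under `μ`. -/
def adjustedErrorSq [MeasurableSpace X] (μ : Measure X) (fstar f : X → ℝ) : ℝ :=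
  ∫ x, (f x + (∫ u, (fstar u - f u) ∂μ) - fstar x) ^ 2 ∂μ

/-- The `ℓ²`-norm empirical covering number of `H` at scale `ε`: the supremum over all `n ≥ 1` and
all `x ∈ Xⁿ` of the covering number of `{(f(x_i))_i : f ∈ H}` for the normalized metric
`d₂(a, b) = (n⁻¹ ∑ |a_i - b_i|²)^{1/2}`. Since `d₂(a, b) ≤ ε` means that the Euclidean distance of
`a` and `b` is at most `ε √n`, this is the Euclidean covering number at radius `ε √n`. -/
def empiricalCoveringNumber (H : Set (X → ℝ)) (ε : ℝ≥0) : ℕ∞ :=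
  ⨆ (n : ℕ) (_ : 1 ≤ n) (x : Fin n → X),
    Metric.externalCoveringNumber (ε * NNReal.sqrt n)
      ((fun f : X → ℝ => (WithLp.toLp 2 (fun i => f (x i)) : EuclideanSpace ℝ (Fin n))) '' H)

/-- `p x` is the density of the noise `ε = Y - f*(X)` given `X = x`, that is, the joint law of
`(X, ε)` has density `p` with respect to (law of `X`) ⊗ (Lebesgue measure). -/
structure IsNoiseDensity [MeasurableSpace X] (ρ : Measure (X × ℝ)) (fstar : X → ℝ)
    (p : X → ℝ → ℝ) : Prop where
  measurable : Measurable (Function.uncurry p)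
  nonneg : ∀ x t, 0 ≤ p x t
  integrable : ∀ x, Integrable (p x)
  integral_eq_one : ∀ x, ∫ t, p x t = 1
  joint_law : ρ.map (fun z : X × ℝ => (z.1, z.2 - fstar z.1)) =
    (ρ.fst.prod volume).withDensity (fun w => ENNReal.ofReal (p w.1 w.2))

/-- The regression model `Y = f*(X) + ε`, `E(ε | X) = 0`, with conditional noise density `p`, is
MEE admissible with bound `M` on the regression function. -/
structure ModelAdmissible [MeasurableSpace X] (ρ : Measure (X × ℝ)) (fstar : X → ℝ)
    (p : X → ℝ → ℝ) (M : ℝ) : Prop where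
  measurable_fstar : Measurable fstar
  density : IsNoiseDensity ρ fstar p
  integrable_noise : ∀ x, Integrable (fun t => t * p x t)
  noise_mean_zero : ∀ x, ∫ t, t * p x t = 0
  density_bounded : ∃ Mp : ℝ, ∀ x t, p x t ≤ Mp
  fstar_bounded : ∀ x, |fstar x| ≤ M
  exists_minimizer : ∃ fR, IsRenyiMinimizer ρ fR

/-- The hypothesis space `H` (a set of continuous functions) is MEE admissible, with uniform
bound `M`. -/
structure HypothesisAdmissible [TopologicalSpace X] [MeasurableSpace X] (ρ : Measure (X × ℝ))
    (fstar : X → ℝ) (H : Set (X → ℝ)) (M : ℝ) : Prop where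
  continuous : ∀ f ∈ H, Continuous f
  bounded : ∀ f ∈ H, ∀ x, |f x| ≤ M
  covering : ∃ c s : ℝ, 0 < c ∧ 0 < s ∧ s < 2 ∧ ∀ ε : ℝ≥0, 0 < ε →
    empiricalCoveringNumber H ε ≠ ⊤ ∧
      Real.log ((empiricalCoveringNumber H ε).toNat : ℝ) ≤ c * (ε : ℝ) ^ (-s)
  minimizer_mem : ∃ fR ∈ H, IsRenyiMinimizer ρ fR
  fstar_mem : fstar ∈ H

/-- The noise class `P₂` with explicit support bound `Mt > 0`: every conditional noise density is
even and supported in `[-Mt, Mt]`. -/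
def SymmetricBoundedNoise (p : X → ℝ → ℝ) (Mt : ℝ) : Prop :=
  0 < Mt ∧ (∀ x, Function.Even (p x)) ∧ ∀ x, Function.support (p x) ⊆ Icc (-Mt) Mt

end MEE

end

/-! Let `e = y - f x`, let `u` be the difference of the noises at two independent observations, and
let `d` be the difference of `f - f*` at the same two points. The information error of `f` is the
mean of `-G_h(u - d)`. Evenness of the conditional noise makes `(x, y) ↦ (x, 2 f* x - y)` preserve
`ρ`. Applied to both observations, it replaces `u - d` by `u + d`, so twice the excess error is the
mean of `2 G_h(u) - G_h(u - d) - G_h(u + d)`. Since `|u| ≤ 2 Mt`, a bandwidth above `2 Mt` makes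
this nonnegative for every `d`, and at least `κ d²` when `d` is bounded. As the mean of `d²` is
twice the variance of `f - f*`, the excess error controls the adjusted `L²` error
(`isMinOn_informationError`, `exists_adjustedErrorSq_le`).

It remains to bound, uniformly over `H`, the deviation of the empirical double sum from its mean.
Freezing one residual as a shift `a` turns the other sum into an empirical mean of `G_h(e - a)`,
that is, of the kernel at the residual of the translate `f + a`. Two applications of a uniform law
over translates therefore suffice (`abs_empiricalPotential_add_informationError_le`), with no
decoupling of the double sum.

The uniform law has subgaussian tails at scale `n ^ (-1/2)` (`exists_measure_uniform_deviation_le`).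
Symmetrization is carried out directly on exponential moments (`integral_exp_iSup_le`), and these
are bounded by chaining (`signAverage_exp_le_of_cover`), which converges because the entropy
exponent is less than 2. Finite subclasses are treated first, so that suprema are measurable;
continuity and separability then give the whole class. -/

namespace MEE

/-- The signed mean `n⁻¹ ∑ ± v i`, with the sign `+` where `σ i` holds. -/
noncomputable def signedMean {n : ℕ} (σ : Fin n → Bool) (v : Fin n → ℝ) : ℝ :=
  (∑ i, cond (σ i) (v i) (-v i)) / n

/-- The average over all sign patterns. -/
noncomputable def signAverage {n : ℕ} (F : (Fin n → Bool) → ℝ) : ℝ :=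
  ∑ σ, (2 ^ n : ℝ)⁻¹ * F σ

/-! ### Exponential moments of random signs and chaining -/

section Signs

variable {n : ℕ}

lemma signedMean_add (σ : Fin n → Bool) (v w : Fin n → ℝ) :
    signedMean σ (v + w) = signedMean σ v + signedMean σ w := by
  unfold signedMean
  rw [← add_div, ← Finset.sum_add_distrib]
  congr 1
  refine Finset.sum_congr rfl fun i _ => ?_
  cases σ i <;> simp [add_comm]

lemma signedMean_sub (σ : Fin n → Bool) (v w : Fin n → ℝ) :
    signedMean σ (v - w) = signedMean σ v - signedMean σ w := by
  have := signedMean_add σ (v - w) w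
  rw [sub_add_cancel] at this
  linarith

lemma signedMean_zero (σ : Fin n → Bool) : signedMean σ (0 : Fin n → ℝ) = 0 := by
  have := signedMean_sub σ (0 : Fin n → ℝ) 0
  simpa using this

lemma signedMean_neg (σ : Fin n → Bool) (v : Fin n → ℝ) :
    signedMean σ (fun i => -v i) = -signedMean σ v := by
  have := signedMean_sub σ 0 v
  rwa [signedMean_zero, zero_sub, zero_sub] at this

lemma signedMean_not (σ : Fin n → Bool) (v : Fin n → ℝ) :
    signedMean (fun i => !σ i) v = -signedMean σ v := by
  unfold signedMean
  rw [← neg_div, ← Finset.sum_neg_distrib]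
  congr 1
  refine Finset.sum_congr rfl fun i _ => ?_
  cases h : σ i <;> simp [h]

lemma signedMean_le (hn : 1 ≤ n) (σ : Fin n → Bool) (v : Fin n → ℝ) {d : ℝ} (hd : 0 ≤ d)
    (hv : ∑ i, v i ^ 2 ≤ n * d ^ 2) : signedMean σ v ≤ d := by
  have hn' : (0 : ℝ) < n := by exact_mod_cast hn
  unfold signedMean
  rw [div_le_iff₀ hn']
  refine le_of_sq_le_sq ?_ (by positivity)
  have h1 := sq_sum_le_card_mul_sum_sq (s := Finset.univ) (f := fun i => cond (σ i) (v i) (-v i))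
  have h2 : ∑ i, (cond (σ i) (v i) (-v i)) ^ 2 = ∑ i, v i ^ 2 :=
    Finset.sum_congr rfl fun i _ => by cases σ i <;> simp
  rw [h2, Finset.card_univ, Fintype.card_fin] at h1
  nlinarith

lemma signAverage_mono {F G : (Fin n → Bool) → ℝ} (h : ∀ σ, F σ ≤ G σ) :
    signAverage F ≤ signAverage G :=
  Finset.sum_le_sum fun σ _ => mul_le_mul_of_nonneg_left (h σ) (by positivity)

lemma signAverage_const (a : ℝ) : signAverage (fun _ : Fin n → Bool => a) = a := by
  simp [signAverage]

lemma signAverage_add (F G : (Fin n → Bool) → ℝ) :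
    signAverage (fun σ => F σ + G σ) = signAverage F + signAverage G := by
  simp [signAverage, mul_add, Finset.sum_add_distrib]

lemma signAverage_const_mul (a : ℝ) (F : (Fin n → Bool) → ℝ) :
    signAverage (fun σ => a * F σ) = a * signAverage F := by
  simp only [signAverage, Finset.mul_sum]
  exact Finset.sum_congr rfl fun σ _ => by ring

lemma signAverage_sum {ι : Type*} (s : Finset ι) (F : ι → (Fin n → Bool) → ℝ) :
    signAverage (fun σ => ∑ k ∈ s, F k σ) = ∑ k ∈ s, signAverage (F k) := by
  simp only [signAverage, Finset.mul_sum]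
  exact Finset.sum_comm

lemma signAverage_not (F : (Fin n → Bool) → ℝ) :
    signAverage (fun σ => F (fun i => !σ i)) = signAverage F := by
  unfold signAverage
  refine Fintype.sum_equiv (Equiv.piCongrRight fun _ => Equiv.boolNot) _ _ fun σ => ?_
  rfl

/-- Signed means are subgaussian. -/
lemma signAverage_exp_le (lam : ℝ) (v : Fin n → ℝ) :
    signAverage (fun σ => Real.exp (lam * signedMean σ v)) ≤
      Real.exp (lam ^ 2 * (∑ i, v i ^ 2) / (2 * (n : ℝ) ^ 2)) := by
  have h1 : ∀ σ : Fin n → Bool, (2 ^ n : ℝ)⁻¹ * Real.exp (lam * signedMean σ v) =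
      ∏ i, (2⁻¹ * Real.exp (cond (σ i) (lam / n * v i) (-(lam / n * v i)))) := by
    intro σ
    rw [Finset.prod_mul_distrib, ← Real.exp_sum]
    congr 1
    · simp
    · congr 1
      rw [signedMean, mul_div_assoc', mul_div_right_comm, Finset.mul_sum]
      refine Finset.sum_congr rfl fun i _ => ?_
      cases σ i <;> simp
  simp only [signAverage, h1]
  -- The signs are independent: the average of the product is a product of averages, each of them a
  -- `cosh`.
  rw [← Fintype.prod_sum fun (i : Fin n) (b : Bool) =>
    (2⁻¹ * Real.exp (cond b (lam / n * v i) (-(lam / n * v i))))]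
  have h2 : ∀ i, ∑ b : Bool, (2⁻¹ * Real.exp (cond b (lam / n * v i) (-(lam / n * v i)))) ≤
      Real.exp ((lam / n * v i) ^ 2 / 2) := by
    intro i
    refine le_trans (le_of_eq ?_) (Real.cosh_le_exp_half_sq _)
    rw [Real.cosh_eq]
    simp
    ring
  refine (Finset.prod_le_prod (fun i _ => by positivity) fun i _ => h2 i).trans (le_of_eq ?_)
  rw [← Real.exp_sum]
  congr 1
  rw [Finset.mul_sum, Finset.sum_div]
  refine Finset.sum_congr rfl fun i _ => ?_
  rcases Nat.eq_zero_or_pos n with rfl | hn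
  · simp
  · have : (n : ℝ) ≠ 0 := by positivity
    field_simp

/-- A maximal inequality over a finite set of vectors. The maximum is replaced by an arbitrary
choice `v σ` of a vector for each sign pattern. -/
lemma signAverage_exp_le_of_finset (hn : 1 ≤ n) (P : Finset (Fin n → ℝ)) {D θ lam : ℝ}
    (hP : ∀ v ∈ P, ∑ i, v i ^ 2 ≤ n * D) (hθ : 1 ≤ θ) (hcard : (P.card : ℝ) ≤ Real.exp θ)
    (v : (Fin n → Bool) → Fin n → ℝ) (hv : ∀ σ, v σ ∈ P) :
    signAverage (fun σ => Real.exp (lam * signedMean σ (v σ))) ≤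
      Real.exp (1 + θ * lam ^ 2 * D / (2 * n)) := by
  have hn' : (0 : ℝ) < n := by exact_mod_cast hn
  have hθ0 : 0 < θ := by linarith
  -- Taking the `θ`-th moment and then the `θ`-th root reduces the union-bound factor, at most `exp
  -- θ`, to the constant `exp 1`.
  have h1 := Real.arith_mean_le_rpow_mean Finset.univ (fun _ : Fin n → Bool => (2 ^ n : ℝ)⁻¹)
    (fun σ => Real.exp (lam * signedMean σ (v σ))) (fun _ _ => by positivity) (by simp)
    (fun _ _ => by positivity) hθ
  refine h1.trans ?_
  have h2 : ∑ σ : Fin n → Bool, (2 ^ n : ℝ)⁻¹ * Real.exp (lam * signedMean σ (v σ)) ^ θ ≤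
      Real.exp (θ + (θ * lam) ^ 2 * D / (2 * n)) := by
    calc ∑ σ : Fin n → Bool, (2 ^ n : ℝ)⁻¹ * Real.exp (lam * signedMean σ (v σ)) ^ θ
        ≤ signAverage (fun σ => ∑ u ∈ P, Real.exp (θ * lam * signedMean σ u)) := by
          refine signAverage_mono fun σ => ?_
          rw [← Real.exp_mul]
          refine le_trans (le_of_eq ?_) (Finset.single_le_sum
            (f := fun u => Real.exp (θ * lam * signedMean σ u)) (fun _ _ => by positivity) (hv σ))
          ring_nf
      _ = ∑ u ∈ P, signAverage (fun σ => Real.exp (θ * lam * signedMean σ u)) :=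
          signAverage_sum _ _
      _ ≤ ∑ u ∈ P, Real.exp ((θ * lam) ^ 2 * D / (2 * n)) := by
          refine Finset.sum_le_sum fun u hu => (signAverage_exp_le _ _).trans ?_
          rw [Real.exp_le_exp]
          calc (θ * lam) ^ 2 * (∑ i, u i ^ 2) / (2 * (n : ℝ) ^ 2)
              ≤ (θ * lam) ^ 2 * (n * D) / (2 * (n : ℝ) ^ 2) := by
                gcongr
                exact hP u hu
            _ = _ := by field_simp
      _ ≤ _ := by
          rw [Finset.sum_const, nsmul_eq_mul, Real.exp_add]
          gcongr
  calc _ ≤ Real.exp (θ + (θ * lam) ^ 2 * D / (2 * n)) ^ (1 / θ) :=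
        Real.rpow_le_rpow (Finset.sum_nonneg fun _ _ => by positivity) h2 (by positivity)
    _ = _ := by
        rw [← Real.exp_mul]
        congr 1
        field_simp

/-- Chaining with external centres: the exponential moment of the signed mean of a selection from a
set of vectors whose covers at scale `L / 2 ^ k` have at most `exp (c τ ^ k)` elements, `τ < 4`. -/
theorem signAverage_exp_le_of_cover (hn : 1 ≤ n) {L c τ : ℝ} (hL : 0 < L) (hc : 0 ≤ c)
    (hτ1 : 1 ≤ τ) (hτ4 : τ < 4) (A : Set (Fin n → ℝ))
    (hA0 : ∀ v ∈ A, ∑ i, v i ^ 2 ≤ n * L ^ 2)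
    (hA : ∀ k : ℕ, 1 ≤ k → ∃ C : Finset (Fin n → ℝ), (C.card : ℝ) ≤ Real.exp (c * τ ^ k) ∧
      ∀ v ∈ A, ∃ u ∈ C, ∑ i, (v i - u i) ^ 2 ≤ n * (L / 2 ^ k) ^ 2)
    {lam : ℝ} (hlam : 0 ≤ lam) (v : (Fin n → Bool) → Fin n → ℝ) (hv : ∀ σ, v σ ∈ A) :
    signAverage (fun σ => Real.exp (lam * signedMean σ (v σ))) ≤
      Real.exp (2 + 5 / 4 * (1 + 5 * c) * L ^ 2 / (1 - √τ / 2) ^ 2 * (lam ^ 2 / n)) := by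
  have hn' : (0 : ℝ) < n := by exact_mod_cast hn
  obtain ⟨C, hC0, hCcard, hCcov⟩ : ∃ C : ℕ → Finset (Fin n → ℝ), C 0 = {0} ∧
      (∀ k, ((C k).card : ℝ) ≤ Real.exp (c * τ ^ k)) ∧
      ∀ k, ∀ v ∈ A, ∃ u ∈ C k, ∑ i, (v i - u i) ^ 2 ≤ n * (L / 2 ^ k) ^ 2 := by
    choose! C hC1 hC2 using hA
    refine ⟨fun k => if k = 0 then {0} else C k, by simp, fun k => ?_, fun k w hw => ?_⟩
    · rcases Nat.eq_zero_or_pos k with rfl | hk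
      · simpa using hc
      · simpa [hk.ne'] using hC1 k hk
    · rcases Nat.eq_zero_or_pos k with rfl | hk
      · simpa using hA0 w hw
      · simpa only [hk.ne', if_false] using hC2 k hk w hw
  choose! π hπC hπ using hCcov
  have hπ0 : ∀ w ∈ A, π 0 w = 0 := fun w hw => by
    have := hπC 0 w hw
    rwa [hC0, Finset.mem_singleton] at this
  set q : ℝ := √τ / 2 with hq
  have hq0 : 0 < q := by positivity
  have hq1 : q < 1 := by
    rw [hq, div_lt_one (by norm_num), Real.sqrt_lt' (by norm_num)]
    linarith
  have hq2 : q ^ 2 = τ / 4 := by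
    rw [hq, div_pow, Real.sq_sqrt (by linarith)]
    norm_num
  set κ : ℝ := 5 / 4 * (1 + 5 * c) * L ^ 2 / (1 - q) ^ 2 with hκ
  have hκ0 : 0 ≤ κ := by positivity
  -- The chain stops once the remainder is deterministically small: it contributes at most one
  -- factor `exp 1`.
  obtain ⟨K, hK⟩ : ∃ K : ℕ, lam * L / 2 ^ K ≤ 1 := by
    obtain ⟨K, hK⟩ := pow_unbounded_of_one_lt (lam * L) (one_lt_two)
    exact ⟨K, by rw [div_le_one (by positivity)]; exact hK.le⟩
  let m : ℕ → (Fin n → Bool) → ℝ := fun k σ =>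
    signedMean σ (π (k + 1) (v σ) - π k (v σ))
  have htel : ∀ σ, signedMean σ (v σ) =
      ∑ k ∈ Finset.range K, m k σ + signedMean σ (v σ - π K (v σ)) := by
    intro σ
    have : ∑ k ∈ Finset.range K, m k σ = signedMean σ (π K (v σ)) - signedMean σ (π 0 (v σ)) := by
      rw [← Finset.sum_range_sub (fun k => signedMean σ (π k (v σ)))]
      exact Finset.sum_congr rfl fun k _ => signedMean_sub _ _ _
    rw [this, hπ0 _ (hv σ), signedMean_zero, signedMean_sub]
    ring
  have hrest : ∀ σ, lam * signedMean σ (v σ - π K (v σ)) ≤ 1 := fun σ => by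
    refine le_trans ?_ hK
    rw [mul_div_assoc]
    exact mul_le_mul_of_nonneg_left
      (signedMean_le hn _ _ (by positivity) (hπ K _ (hv σ))) hlam
  -- Convexity of `exp` distributes the chain over its levels. Geometric weights of ratio `q = √τ /
  -- 2` exactly balance the entropy growth `τ ^ k` against the decay `4 ^ (-k)` of the squared link
  -- lengths; the leftover mass `q ^ K` is placed at `0`.
  let w : ℕ → ℝ := fun k => (1 - q) * q ^ k
  have hw0 : ∀ k, 0 < w k := fun k => mul_pos (by linarith) (by positivity)
  have hw1 : q ^ K + ∑ k ∈ Finset.range K, w k = 1 := by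
    rw [← Finset.mul_sum, mul_comm, geom_sum_mul_neg]
    ring
  have hpt : ∀ σ, Real.exp (lam * signedMean σ (v σ)) ≤
      Real.exp 1 * (q ^ K + ∑ k ∈ Finset.range K, w k * Real.exp (lam / w k * m k σ)) := by
    intro σ
    have h1 : lam * signedMean σ (v σ) ≤ 1 + lam * ∑ k ∈ Finset.range K, m k σ := by
      rw [htel σ, mul_add]
      linarith [hrest σ]
    have h2 := convexOn_exp.map_add_sum_le (t := Finset.range K) (w := w)
      (p := fun k => lam / w k * m k σ) (v := q ^ K) (q := 0) (fun k _ => (hw0 k).le) hw1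
      (fun _ _ => mem_univ _) (by positivity) (mem_univ _)
    have h3 : ∑ k ∈ Finset.range K, w k * (lam / w k * m k σ) =
        lam * ∑ k ∈ Finset.range K, m k σ := by
      rw [Finset.mul_sum]
      refine Finset.sum_congr rfl fun k _ => ?_
      have := (hw0 k).ne'
      field_simp
    simp only [smul_eq_mul, mul_zero, zero_add, Real.exp_zero, mul_one] at h2
    rw [h3] at h2
    refine (Real.exp_le_exp.2 h1).trans ?_
    rw [Real.exp_add]
    exact mul_le_mul_of_nonneg_left h2 (by positivity)
  have hlevel : ∀ k, signAverage (fun σ => Real.exp (lam / w k * m k σ)) ≤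
      Real.exp (1 + κ * (lam ^ 2 / n)) := by
    intro k
    have hτ0 : 0 < τ := by linarith
    have hτk : 1 ≤ τ ^ k := one_le_pow₀ hτ1
    let D : ℝ := 5 / 2 * (L / 2 ^ k) ^ 2
    -- Two arbitrary centres may be far apart, so only short differences are kept. The links that
    -- occur are short: `2 + 2 / 4 = 5 / 2` bounds their normalized square in units of `(L / 2 ^ k)
    -- ^ 2`.
    let P : Finset (Fin n → ℝ) :=
      (((C (k + 1)) ×ˢ (C k)).image fun u => u.1 - u.2).filter fun u => ∑ i, u i ^ 2 ≤ n * D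
    have hcard : (P.card : ℝ) ≤ Real.exp ((1 + 5 * c) * τ ^ k) := by
      have h1 : P.card ≤ (C (k + 1)).card * (C k).card :=
        (Finset.card_filter_le _ _).trans (Finset.card_image_le.trans
          (Finset.card_product _ _).le)
      calc (P.card : ℝ) ≤ (C (k + 1)).card * (C k).card := by exact_mod_cast h1
        _ ≤ Real.exp (c * τ ^ (k + 1)) * Real.exp (c * τ ^ k) := by
            gcongr
            · exact hCcard _
            · exact hCcard _
        _ ≤ _ := by
            rw [← Real.exp_add, Real.exp_le_exp, pow_succ]
            have : c * (τ ^ k * τ) ≤ c * (τ ^ k * 4) := by gcongr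
            nlinarith
    refine (signAverage_exp_le_of_finset hn P (D := D) (θ := (1 + 5 * c) * τ ^ k)
      (fun u hu => (Finset.mem_filter.1 hu).2) ?_ hcard
      (fun σ => π (k + 1) (v σ) - π k (v σ)) fun σ => ?_).trans (le_of_eq ?_)
    · nlinarith [mul_nonneg hc (zero_le_one.trans hτk)]
    · refine Finset.mem_filter.2 ⟨Finset.mem_image.2 ⟨(π (k + 1) (v σ), π k (v σ)),
        Finset.mem_product.2 ⟨hπC _ _ (hv σ), hπC _ _ (hv σ)⟩, rfl⟩, ?_⟩
      have h1 := hπ k _ (hv σ)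
      have h2 := hπ (k + 1) _ (hv σ)
      have h3 : ∑ i, (π (k + 1) (v σ) - π k (v σ)) i ^ 2 ≤
          2 * ∑ i, (v σ i - π k (v σ) i) ^ 2 + 2 * ∑ i, (v σ i - π (k + 1) (v σ) i) ^ 2 := by
        rw [Finset.mul_sum, Finset.mul_sum, ← Finset.sum_add_distrib]
        refine Finset.sum_le_sum fun i _ => ?_
        simp only [Pi.sub_apply]
        nlinarith [sq_nonneg ((v σ i - π k (v σ) i) + (v σ i - π (k + 1) (v σ) i))]
      have h4 : (L / 2 ^ (k + 1)) ^ 2 = (L / 2 ^ k) ^ 2 / 4 := by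
        rw [pow_succ]; field_simp; ring
      rw [h4] at h2
      simp only [D]
      linarith
    -- The factors `τ ^ k` and `4 ^ k` cancel, which makes the bound the same at every level.
    · have hqk : (q ^ k) ^ 2 = τ ^ k / (2 ^ k) ^ 2 := by
        rw [← pow_mul, mul_comm, pow_mul, hq2, div_pow, ← pow_mul, mul_comm k, pow_mul]
        norm_num
      have h1q : (1 - q) ≠ 0 := by linarith
      congr 2
      simp only [w, D, hκ]
      rw [div_pow, mul_pow, hqk]
      field_simp
      ring
  calc signAverage (fun σ => Real.exp (lam * signedMean σ (v σ)))
      ≤ signAverage (fun σ => Real.exp 1 *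
          (q ^ K + ∑ k ∈ Finset.range K, w k * Real.exp (lam / w k * m k σ))) :=
        signAverage_mono hpt
    _ = Real.exp 1 * (q ^ K + ∑ k ∈ Finset.range K,
          w k * signAverage (fun σ => Real.exp (lam / w k * m k σ))) := by
        rw [signAverage_const_mul, signAverage_add, signAverage_const, signAverage_sum]
        simp only [signAverage_const_mul]
    _ ≤ Real.exp 1 * (q ^ K * Real.exp (1 + κ * (lam ^ 2 / n)) + ∑ k ∈ Finset.range K,
          w k * Real.exp (1 + κ * (lam ^ 2 / n))) := by
        gcongr with k hk
        · refine le_mul_of_one_le_right (by positivity) ?_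
          rw [Real.one_le_exp_iff]
          positivity
        · exact hlevel k
    _ = _ := by
        rw [← Finset.sum_mul, ← add_mul, hw1, one_mul, ← Real.exp_add]
        congr 1
        ring

end Signs

/-! ### Symmetrization and subgaussian tails for finite classes -/

section Symmetrization

variable {Ω : Type*} {ι : Type*} {n : ℕ}

/-- The mean of `φ` over the sample `z`. -/
noncomputable def sampleMean (φ : Ω → ℝ) (z : Fin n → Ω) : ℝ := (∑ i, φ (z i)) / n

lemma abs_sampleMean_le (hn : 1 ≤ n) {φ : Ω → ℝ} {B : ℝ} (hB : ∀ ω, |φ ω| ≤ B) (z : Fin n → Ω) :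
    |sampleMean φ z| ≤ B := by
  have hn' : (0 : ℝ) < n := by exact_mod_cast hn
  rw [sampleMean, abs_div, Nat.abs_cast, div_le_iff₀ hn']
  refine (Finset.abs_sum_le_sum_abs _ _).trans ((Finset.sum_le_sum fun i _ => hB (z i)).trans ?_)
  simp [mul_comm]

variable [MeasurableSpace Ω]

/-- Exchanging chosen observations with their ghost copies does not change the joint law. This
invariance is what introduces the random signs. -/
lemma measurePreserving_signSwap (P : Measure Ω) [IsProbabilityMeasure P] (σ : Fin n → Bool) :
    MeasurePreserving (fun (w : Fin n → Ω × Ω) i => cond (σ i) (w i) (w i).swap)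
      (Measure.pi fun _ => P.prod P) (Measure.pi fun _ => P.prod P) := by
  refine measurePreserving_pi (fun _ => P.prod P) (fun _ => P.prod P)
    (f := fun i (x : Ω × Ω) => cond (σ i) x x.swap) fun i => ?_
  cases σ i
  · exact Measure.measurePreserving_swap
  · exact MeasurePreserving.id _

lemma measurable_sampleMean {φ : Ω → ℝ} (hφ : Measurable φ) :
    Measurable (sampleMean φ : (Fin n → Ω) → ℝ) := by
  unfold sampleMean
  fun_prop

lemma integrable_of_abs_le {P : Measure Ω} [IsFiniteMeasure P] {φ : Ω → ℝ} (hφ : Measurable φ)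
    {B : ℝ} (hB : ∀ ω, |φ ω| ≤ B) : Integrable φ P :=
  Integrable.of_bound hφ.aestronglyMeasurable B (ae_of_all _ hB)

lemma abs_integral_le_of_abs_le (P : Measure Ω) [IsProbabilityMeasure P] {φ : Ω → ℝ} {B : ℝ}
    (hB : ∀ ω, |φ ω| ≤ B) : |∫ ω, φ ω ∂P| ≤ B := by
  simpa using norm_integral_le_of_norm_le_const (μ := P) (f := φ) (ae_of_all _ hB)

lemma integrable_exp_mul_iSup {P : Measure Ω} [IsFiniteMeasure P] [Finite ι] [Nonempty ι]
    {φ : ι → Ω → ℝ} (hφ : ∀ θ, Measurable (φ θ)) {B lam : ℝ} (hB : ∀ θ ω, φ θ ω ≤ B)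
    (hlam : 0 ≤ lam) : Integrable (fun ω => Real.exp (lam * ⨆ θ, φ θ ω)) P := by
  refine integrable_of_abs_le (B := Real.exp (lam * B)) ?_ fun a => ?_
  · exact Real.measurable_exp.comp (measurable_const.mul (Measurable.iSup hφ))
  · rw [Real.abs_exp, Real.exp_le_exp]
    exact mul_le_mul_of_nonneg_left (ciSup_le fun θ => hB θ a) hlam

lemma integral_sampleMean (P : Measure Ω) [IsProbabilityMeasure P] (hn : 1 ≤ n) {φ : Ω → ℝ}
    (hφ : Measurable φ) {B : ℝ} (hB : ∀ ω, |φ ω| ≤ B) :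
    ∫ z, sampleMean φ z ∂(Measure.pi fun _ : Fin n => P) = ∫ ω, φ ω ∂P := by
  have hn' : (0 : ℝ) < n := by exact_mod_cast hn
  simp only [sampleMean]
  rw [integral_div, integral_finsetSum]
  · have : ∀ i : Fin n, ∫ z : Fin n → Ω, φ (z i) ∂(Measure.pi fun _ => P) = ∫ ω, φ ω ∂P :=
      fun i => integral_comp_eval (μ := fun _ : Fin n => P) hφ.aestronglyMeasurable
    simp only [this]
    simp
    field_simp
  · exact fun i _ => integrable_of_abs_le (hφ.comp (measurable_pi_apply i)) fun z => hB (z i)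

/-- Symmetrization at the level of exponential moments. -/
theorem integral_exp_iSup_le (P : Measure Ω) [IsProbabilityMeasure P] [Finite ι] [Nonempty ι]
    (hn : 1 ≤ n) (g : ι → Ω → ℝ) (hg : ∀ θ, Measurable (g θ)) {B : ℝ} (hB : ∀ θ ω, |g θ ω| ≤ B)
    {lam K : ℝ} (hlam : 0 ≤ lam)
    (hK : ∀ (z : Fin n → Ω) (θ : (Fin n → Bool) → ι),
      signAverage (fun σ => Real.exp (2 * lam * signedMean σ fun i => g (θ σ) (z i))) ≤ K) :
    ∫ z, Real.exp (lam * ⨆ θ, (sampleMean (g θ) z - ∫ ω, g θ ω ∂P))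
      ∂(Measure.pi fun _ : Fin n => P) ≤ K := by
  let Q : Measure (Fin n → Ω) := Measure.pi fun _ => P
  let Q2 : Measure (Fin n → Ω × Ω) := Measure.pi fun _ => P.prod P
  have hbdd : ∀ φ : ι → ℝ, BddAbove (Set.range φ) := fun φ => (Set.finite_range φ).bddAbove
  have hsub : ∀ θ (z z' : Fin n → Ω), sampleMean (g θ) z - sampleMean (g θ) z' ≤ 2 * B := by
    intro θ z z'
    have h1 := abs_le.1 (abs_sampleMean_le hn (hB θ) z)
    have h2 := abs_le.1 (abs_sampleMean_le hn (hB θ) z')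
    linarith
  have hgi : ∀ θ, |∫ ω, g θ ω ∂P| ≤ B := fun θ => abs_integral_le_of_abs_le P (hB θ)
  -- Jensen over a ghost sample `z'`, applied at an index attaining the supremum for `z`; finiteness
  -- of the class provides that index.
  have hA : ∀ z : Fin n → Ω, Real.exp (lam * ⨆ θ, (sampleMean (g θ) z - ∫ ω, g θ ω ∂P)) ≤
      ∫ z', Real.exp (lam * ⨆ θ, (sampleMean (g θ) z - sampleMean (g θ) z')) ∂Q := by
    intro z
    obtain ⟨θ, hθ⟩ := exists_eq_ciSup_of_finite
      (f := fun θ => sampleMean (g θ) z - ∫ ω, g θ ω ∂P)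
    have hiz : Integrable (fun z' : Fin n → Ω => sampleMean (g θ) z') Q :=
      integrable_of_abs_le (measurable_sampleMean (hg θ)) (abs_sampleMean_le hn (hB θ))
    have h1 : lam * (sampleMean (g θ) z - ∫ ω, g θ ω ∂P) =
        ∫ z', lam * (sampleMean (g θ) z - sampleMean (g θ) z') ∂Q := by
      rw [integral_const_mul, integral_sub (integrable_const _) hiz,
        integral_sampleMean P hn (hg θ) (hB θ)]
      simp
    rw [← hθ, h1]
    have hmeas : Measurable fun z' : Fin n → Ω => lam * (sampleMean (g θ) z - sampleMean (g θ) z') :=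
      measurable_const.mul (measurable_const.sub (measurable_sampleMean (hg θ)))
    have hi2 : Integrable (fun z' : Fin n → Ω => Real.exp
        (lam * (sampleMean (g θ) z - sampleMean (g θ) z'))) Q := by
      refine integrable_of_abs_le (B := Real.exp (lam * (2 * B)))
        (Real.measurable_exp.comp hmeas) fun a => ?_
      rw [Real.abs_exp, Real.exp_le_exp]
      exact mul_le_mul_of_nonneg_left (hsub _ _ _) hlam
    have hj := convexOn_exp.map_integral_le (μ := Q)
      (f := fun z' => lam * (sampleMean (g θ) z - sampleMean (g θ) z'))
      Real.continuous_exp.continuousOn isClosed_univ (ae_of_all _ fun _ => mem_univ _)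
      (((integrable_const _).sub hiz).const_mul lam) hi2
    refine hj.trans ?_
    refine integral_mono hi2 (integrable_exp_mul_iSup (fun θ => measurable_const.sub
      (measurable_sampleMean (hg θ))) (fun θ a => hsub θ _ _) hlam) fun z' => ?_
    exact Real.exp_le_exp.2 (mul_le_mul_of_nonneg_left
      (le_ciSup (f := fun θ => sampleMean (g θ) z - sampleMean (g θ) z') (hbdd _) θ) hlam)
  let S : (Fin n → Bool) → (Fin n → Ω × Ω) → ℝ := fun σ w =>
    ⨆ θ, signedMean σ fun i => g θ (w i).1 - g θ (w i).2
  have hprod : Integrable (fun zz : (Fin n → Ω) × (Fin n → Ω) =>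
      Real.exp (lam * ⨆ θ, (sampleMean (g θ) zz.1 - sampleMean (g θ) zz.2))) (Q.prod Q) := by
    refine integrable_exp_mul_iSup (B := 2 * B) (fun θ => ?_) (fun θ _ => hsub θ _ _) hlam
    have h1 : Measurable fun z : Fin n → Ω => sampleMean (g θ) z := measurable_sampleMean (hg θ)
    exact (h1.comp measurable_fst).sub (h1.comp measurable_snd)
  have hsm : ∀ θ (w : Fin n → Ω × Ω),
      sampleMean (g θ) (fun i => (w i).1) - sampleMean (g θ) (fun i => (w i).2) =
        (∑ i, (g θ (w i).1 - g θ (w i).2)) / n := by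
    intro θ w
    rw [sampleMean, sampleMean, ← sub_div, Finset.sum_sub_distrib]
  have hSmeas : ∀ σ, Measurable (S σ) := fun σ => by
    refine Measurable.iSup (f := fun θ (w : Fin n → Ω × Ω) =>
      signedMean σ fun i => g θ (w i).1 - g θ (w i).2) fun θ => ?_
    unfold signedMean
    refine Measurable.div_const (Finset.measurable_fun_sum _ fun i _ => ?_) _
    have h0 : Measurable fun w : Fin n → Ω × Ω => g θ (w i).1 - g θ (w i).2 :=
      ((hg θ).comp (measurable_fst.comp (measurable_pi_apply i))).sub
        ((hg θ).comp (measurable_snd.comp (measurable_pi_apply i)))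
    cases σ i
    · exact h0.neg
    · exact h0
  have hswap : ∀ σ (w : Fin n → Ω × Ω), S (fun _ => true)
      (fun i => cond (σ i) (w i) (w i).swap) = S σ w := by
    intro σ w
    simp only [S, signedMean]
    congr 1
    funext θ
    congr 1
    refine Finset.sum_congr rfl fun i _ => ?_
    cases σ i <;> simp
  have hSle : ∀ σ w, S σ w ≤ 2 * B := by
    intro σ w
    rw [← hswap]
    refine ciSup_le fun θ => ?_
    refine le_trans (le_of_eq ?_) (hsub θ (fun i => (cond (σ i) (w i) (w i).swap).1)
      (fun i => (cond (σ i) (w i) (w i).swap).2))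
    rw [hsm θ fun i => cond (σ i) (w i) (w i).swap, signedMean]
    simp
  have hSint : ∀ σ, Integrable (fun w => Real.exp (lam * S σ w)) Q2 := by
    intro σ
    refine integrable_of_abs_le (B := Real.exp (lam * (2 * B)))
      (Real.measurable_exp.comp (measurable_const.mul (hSmeas σ))) fun a => ?_
    rw [Real.abs_exp, Real.exp_le_exp]
    exact mul_le_mul_of_nonneg_left (hSle σ a) hlam
  have hC : ∀ σ, ∫ w, Real.exp (lam * S (fun _ => true) w) ∂Q2 =
      ∫ w, Real.exp (lam * S σ w) ∂Q2 := by
    intro σ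
    have hmp := measurePreserving_signSwap (n := n) P σ
    have hm : AEStronglyMeasurable (fun w => Real.exp (lam * S (fun _ => true) w)) (Q2.map
        fun w i => cond (σ i) (w i) (w i).swap) :=
      (Real.measurable_exp.comp (measurable_const.mul (hSmeas _))).aestronglyMeasurable
    have h1 := integral_map hmp.measurable.aemeasurable hm
    rw [hmp.map_eq] at h1
    simpa only [hswap] using h1
  have hD : ∀ w, signAverage (fun σ => Real.exp (lam * S σ w)) ≤ K := by
    intro w
    have hex : ∀ σ, ∃ θ, signedMean σ (fun i => g θ (w i).1 - g θ (w i).2) = S σ w := fun σ =>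
      exists_eq_ciSup_of_finite (f := fun θ => signedMean σ fun i => g θ (w i).1 - g θ (w i).2)
    choose θ hθ using hex
    -- Convexity separates the sample from its ghost, which doubles `lam`. The ghost carries the
    -- opposite signs; the double negation puts its term in a form to which `signAverage_not`
    -- applies.
    have h1 : ∀ σ, Real.exp (lam * S σ w) ≤
        2⁻¹ * Real.exp (2 * lam * signedMean σ fun i => g (θ σ) (w i).1) +
        2⁻¹ * Real.exp (2 * lam * signedMean (fun i => !σ i) fun i =>
          g (θ fun i => !!σ i) (w i).2) := by
      intro σ
      have h2 : S σ w = (signedMean σ fun i => g (θ σ) (w i).1) +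
          signedMean (fun i => !σ i) fun i => g (θ σ) (w i).2 := by
        rw [← hθ σ, signedMean_not, ← sub_eq_add_neg, ← signedMean_sub]
        rfl
      simp only [Bool.not_not]
      have h3 := convexOn_exp.2
        (mem_univ (2 * lam * signedMean σ fun i => g (θ σ) (w i).1))
        (mem_univ (2 * lam * signedMean (fun i => !σ i) fun i => g (θ σ) (w i).2))
        (inv_nonneg.2 zero_le_two) (inv_nonneg.2 zero_le_two)
        (show (2 : ℝ)⁻¹ + 2⁻¹ = 1 by norm_num)
      simp only [smul_eq_mul] at h3
      refine le_trans (le_of_eq ?_) h3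
      rw [h2]
      congr 1
      ring
    refine (signAverage_mono h1).trans ?_
    rw [signAverage_add, signAverage_const_mul, signAverage_const_mul,
      signAverage_not (fun σ => Real.exp (2 * lam * signedMean σ fun i =>
          g (θ fun i => !σ i) (w i).2))]
    have h4 := hK (fun i => (w i).1) θ
    have h5 := hK (fun i => (w i).2) fun σ => θ fun i => !σ i
    linarith
  calc ∫ z, Real.exp (lam * ⨆ θ, (sampleMean (g θ) z - ∫ ω, g θ ω ∂P)) ∂Q
      ≤ ∫ z, ∫ z', Real.exp (lam * ⨆ θ, (sampleMean (g θ) z - sampleMean (g θ) z')) ∂Q ∂Q := by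
        refine integral_mono (integrable_exp_mul_iSup (B := 2 * B) (fun θ =>
          (measurable_sampleMean (hg θ)).sub measurable_const) (fun θ z => ?_) hlam)
          hprod.integral_prod_left hA
        have h1 := abs_le.1 (abs_sampleMean_le hn (hB θ) z)
        have h2 := abs_le.1 (hgi θ)
        change sampleMean (g θ) z - ∫ ω, g θ ω ∂P ≤ 2 * B
        linarith
    _ = ∫ zz, Real.exp (lam * ⨆ θ, (sampleMean (g θ) zz.1 - sampleMean (g θ) zz.2))
          ∂(Q.prod Q) := (integral_prod _ hprod).symm
    _ = ∫ w, Real.exp (lam * S (fun _ => true) w) ∂Q2 := by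
        have hmp := measurePreserving_arrowProdEquivProdArrow Ω Ω (Fin n) (fun _ => P) fun _ => P
        rw [← hmp.integral_comp']
        refine integral_congr_ae (ae_of_all _ fun w => ?_)
        simp only [S]
        congr 2
        congr 1
        funext θ
        refine (hsm θ w).trans ?_
        simp [signedMean]
    _ = signAverage (fun σ : Fin n → Bool => ∫ w, Real.exp (lam * S σ w) ∂Q2) := by
        rw [← signAverage_const (n := n) (∫ w, Real.exp (lam * S (fun _ => true) w) ∂Q2)]
        congr 1
        funext σ
        exact hC σ
    _ = ∫ w, signAverage (fun σ => Real.exp (lam * S σ w)) ∂Q2 := by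
        simp only [signAverage]
        rw [integral_finsetSum _ fun σ _ => (hSint σ).const_mul _]
        simp only [integral_const_mul]
    _ ≤ ∫ _, K ∂Q2 := by
        refine integral_mono ?_ (integrable_const _) hD
        simp only [signAverage]
        exact integrable_finsetSum _ fun σ _ => (hSint σ).const_mul _
    _ = K := by simp

/-- Subgaussian tails of the supremum of an empirical process over a finite class. -/
theorem measure_exists_lt_sampleMean_le (P : Measure Ω) [IsProbabilityMeasure P] [Finite ι]
    (hn : 1 ≤ n) (g : ι → Ω → ℝ) (hg : ∀ θ, Measurable (g θ)) {B : ℝ} (hB : ∀ θ ω, |g θ ω| ≤ B)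
    {κ : ℝ} (hκ : 0 < κ)
    (hK : ∀ (z : Fin n → Ω) (θ : (Fin n → Bool) → ι) (lam : ℝ), 0 ≤ lam →
      signAverage (fun σ => Real.exp (lam * signedMean σ fun i => g (θ σ) (z i))) ≤
        Real.exp (2 + κ * (lam ^ 2 / n)))
    {t : ℝ} (ht : 0 ≤ t) :
    (Measure.pi fun _ : Fin n => P) {z | ∃ θ, t < sampleMean (g θ) z - ∫ ω, g θ ω ∂P} ≤
      ENNReal.ofReal (Real.exp (2 - t ^ 2 * n / (16 * κ))) := by
  have hn' : (0 : ℝ) < n := by exact_mod_cast hn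
  rcases isEmpty_or_nonempty ι with hι | hι
  · simp
  let Q : Measure (Fin n → Ω) := Measure.pi fun _ => P
  let S : (Fin n → Ω) → ℝ := fun z => ⨆ θ, (sampleMean (g θ) z - ∫ ω, g θ ω ∂P)
  have hS : Measurable S := Measurable.iSup fun θ => (measurable_sampleMean (hg θ)).sub_const _
  -- This minimizes the Chernoff exponent `-lam * t + 4 * κ * lam ^ 2 / n`; the 4 comes from the
  -- doubling of `lam` in symmetrization.
  set lam : ℝ := t * n / (8 * κ) with hlam
  have hlam0 : 0 ≤ lam := by positivity
  have h1 := integral_exp_iSup_le P hn g hg hB hlam0 fun z θ => hK z θ (2 * lam) (by positivity)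
  have hint : Integrable (fun z => Real.exp (lam * S z)) Q := by
    refine integrable_exp_mul_iSup (B := 2 * B)
      (fun θ => (measurable_sampleMean (hg θ)).sub_const _) (fun θ z => ?_) hlam0
    have h2 := abs_le.1 (abs_sampleMean_le hn (hB θ) z)
    have h3 : |∫ ω, g θ ω ∂P| ≤ B := abs_integral_le_of_abs_le P (hB θ)
    have h4 := abs_le.1 h3
    linarith
  have h2 := measure_ge_le_exp_mul_mgf (μ := Q) (X := S) t hlam0 hint
  calc Q {z | ∃ θ, t < sampleMean (g θ) z - ∫ ω, g θ ω ∂P}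
      ≤ Q {z | t ≤ S z} := by
        refine measure_mono ?_
        rintro z ⟨θ, hθ⟩
        exact hθ.le.trans (le_ciSup (f := fun θ => sampleMean (g θ) z - ∫ ω, g θ ω ∂P)
          (Set.finite_range _).bddAbove θ)
    _ = ENNReal.ofReal (Q.real {z | t ≤ S z}) := by simp
    _ ≤ _ := by
        refine ENNReal.ofReal_le_ofReal (h2.trans ?_)
        refine (mul_le_mul_of_nonneg_left h1 (by positivity)).trans (le_of_eq ?_)
        rw [← Real.exp_add]
        congr 1
        rw [hlam]
        field_simp
        ring

end Symmetrization

/-! ### Lipschitz and concavity-type bounds for the Gaussian kernel -/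

section Kernel

variable {h : ℝ}

lemma gaussKernel_neg (h t : ℝ) : gaussKernel h (-t) = gaussKernel h t := by
  simp [gaussKernel]

lemma gaussKernel_pos (hh : 0 < h) (t : ℝ) : 0 < gaussKernel h t := by
  unfold gaussKernel
  have := Real.pi_pos
  positivity

lemma gaussKernel_le_of_abs_le (hh : 0 < h) {s t : ℝ} (hst : |s| ≤ |t|) :
    gaussKernel h t ≤ gaussKernel h s := by
  unfold gaussKernel
  have := Real.pi_pos
  have h1 := sq_le_sq.2 hst
  gcongr

lemma gaussKernel_le (hh : 0 < h) (t : ℝ) : gaussKernel h t ≤ gaussKernel h 0 :=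
  gaussKernel_le_of_abs_le hh (by simp)

lemma abs_gaussKernel_le (hh : 0 < h) (t : ℝ) : |gaussKernel h t| ≤ gaussKernel h 0 := by
  rw [abs_of_pos (gaussKernel_pos hh t)]
  exact gaussKernel_le hh t

lemma continuous_gaussKernel (h : ℝ) : Continuous (gaussKernel h) := by
  unfold gaussKernel
  fun_prop

/-- With `v = |x| / h`, the derivative bound reduces to `v ≤ 1 + v ^ 2 / 2 ≤ exp (v ^ 2 / 2)`. -/
lemma gaussKernel_lipschitz (hh : 0 < h) (s t : ℝ) :
    |gaussKernel h s - gaussKernel h t| ≤ gaussKernel h 0 / h * |s - t| := by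
  have hA : gaussKernel h 0 = 1 / (√(2 * Real.pi) * h) := by simp [gaussKernel]
  have hA0 : 0 < 1 / (√(2 * Real.pi) * h) := hA ▸ gaussKernel_pos hh 0
  have hder : ∀ x, HasDerivAt (gaussKernel h) (1 / (√(2 * Real.pi) * h) *
      (Real.exp (-(x ^ 2 / (2 * h ^ 2))) * -(2 * x / (2 * h ^ 2)))) x := by
    intro x
    have h1 : HasDerivAt (fun x : ℝ => -(x ^ 2 / (2 * h ^ 2))) (-(2 * x / (2 * h ^ 2))) x := by
      simpa using ((hasDerivAt_pow 2 x).div_const (2 * h ^ 2)).fun_neg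
    exact h1.exp.const_mul _
  have hbound : ∀ x, ‖1 / (√(2 * Real.pi) * h) *
      (Real.exp (-(x ^ 2 / (2 * h ^ 2))) * -(2 * x / (2 * h ^ 2)))‖ ≤ gaussKernel h 0 / h := by
    intro x
    rw [hA, norm_mul, norm_mul, norm_neg, Real.norm_eq_abs, Real.norm_eq_abs, Real.norm_eq_abs,
      abs_of_pos hA0, Real.abs_exp, Real.exp_neg]
    generalize 1 / (√(2 * Real.pi) * h) = A at hA0
    have h1 : |2 * x / (2 * h ^ 2)| ≤ h⁻¹ * Real.exp (x ^ 2 / (2 * h ^ 2)) := by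
      have h2 : |2 * x / (2 * h ^ 2)| = h⁻¹ * (|x| / h) := by
        rw [abs_div, abs_mul, abs_of_pos (by positivity : (0 : ℝ) < 2 * h ^ 2), abs_two]
        field_simp
      rw [h2]
      refine mul_le_mul_of_nonneg_left ?_ (by positivity)
      have h3 := Real.add_one_le_exp (x ^ 2 / (2 * h ^ 2))
      have h4 : x ^ 2 / (2 * h ^ 2) = (|x| / h) ^ 2 / 2 := by
        rw [div_pow, sq_abs]; field_simp
      rw [h4] at h3 ⊢
      nlinarith [sq_nonneg (|x| / h - 1)]
    calc A * ((Real.exp (x ^ 2 / (2 * h ^ 2)))⁻¹ * |2 * x / (2 * h ^ 2)|)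
        ≤ A * ((Real.exp (x ^ 2 / (2 * h ^ 2)))⁻¹ * (h⁻¹ * Real.exp (x ^ 2 / (2 * h ^ 2)))) := by
          gcongr
      _ = A * (1 / h) := by
          have := Real.exp_pos (x ^ 2 / (2 * h ^ 2))
          field_simp
      _ = A / h := by ring
  exact convex_univ.norm_image_sub_le_of_norm_hasDerivWithin_le
    (fun x _ => (hder x).hasDerivWithinAt) (fun x _ => hbound x) (mem_univ t) (mem_univ s)

/-- The sum equals `2 G_h(u) exp (-d² / (2h²)) cosh (u d / h²)`, and `cosh v ≤ exp (v² / 2)`. The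
resulting rate in `d²` is positive exactly when `|u| < h`, whatever the size of `d`. -/
lemma gaussKernel_sub_add_add_le_exp (hh : 0 < h) (u d : ℝ) :
    gaussKernel h (u - d) + gaussKernel h (u + d) ≤
      2 * gaussKernel h u * Real.exp (-((1 - u ^ 2 / h ^ 2) / (2 * h ^ 2) * d ^ 2)) := by
  have h1 : gaussKernel h (u - d) + gaussKernel h (u + d) =
      2 * gaussKernel h u * (Real.exp (-(d ^ 2 / (2 * h ^ 2))) * Real.cosh (u * d / h ^ 2)) := by
    have e1 : -((u - d) ^ 2 / (2 * h ^ 2)) =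
        -(u ^ 2 / (2 * h ^ 2)) + -(d ^ 2 / (2 * h ^ 2)) + u * d / h ^ 2 := by
      field_simp; ring
    have e2 : -((u + d) ^ 2 / (2 * h ^ 2)) =
        -(u ^ 2 / (2 * h ^ 2)) + -(d ^ 2 / (2 * h ^ 2)) + -(u * d / h ^ 2) := by
      field_simp; ring
    simp only [gaussKernel, e1, e2, Real.exp_add, Real.cosh_eq]
    ring
  rw [h1]
  refine mul_le_mul_of_nonneg_left ?_ (by linarith [gaussKernel_pos hh u])
  refine (mul_le_mul_of_nonneg_left (Real.cosh_le_exp_half_sq _) (by positivity)).trans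
    (le_of_eq ?_)
  rw [← Real.exp_add]
  congr 1
  field_simp
  ring

lemma gaussKernel_sub_add_add_le (hh : 0 < h) {u : ℝ} (hu : |u| ≤ h) (d : ℝ) :
    gaussKernel h (u - d) + gaussKernel h (u + d) ≤ 2 * gaussKernel h u := by
  refine (gaussKernel_sub_add_add_le_exp hh u d).trans ?_
  refine mul_le_of_le_one_right (by linarith [gaussKernel_pos hh u]) ?_
  rw [Real.exp_le_one_iff, neg_nonpos]
  have h1 : u ^ 2 / h ^ 2 ≤ 1 := by
    rw [div_le_one (by positivity)]
    exact sq_le_sq.2 (by rwa [abs_of_pos hh])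
  have h2 : 0 ≤ 1 - u ^ 2 / h ^ 2 := by linarith
  positivity

/-- Quantitative concavity gap of the Gaussian kernel inside its bandwidth. -/
lemma exists_le_gaussKernel_sub (hh : 0 < h) {a b : ℝ} (ha0 : 0 ≤ a) (ha : a < h) :
    ∃ κ : ℝ, 0 < κ ∧ ∀ u d : ℝ, |u| ≤ a → |d| ≤ b →
      κ * d ^ 2 ≤ 2 * gaussKernel h u - (gaussKernel h (u - d) + gaussKernel h (u + d)) := by
  set β : ℝ := (1 - a ^ 2 / h ^ 2) / (2 * h ^ 2) with hβ
  have hβ0 : 0 < β := by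
    have : a ^ 2 / h ^ 2 < 1 := by
      rw [div_lt_one (by positivity)]
      gcongr
    have : 0 < 1 - a ^ 2 / h ^ 2 := by linarith
    positivity
  have hGa := gaussKernel_pos hh a
  refine ⟨2 * gaussKernel h a * (β / (1 + β * b ^ 2)), by positivity, fun u d hu hd => ?_⟩
  have hu2 : u ^ 2 ≤ a ^ 2 := sq_le_sq.2 (by rwa [abs_of_nonneg ha0])
  have hd2 : d ^ 2 ≤ b ^ 2 := sq_le_sq.2 (hd.trans (le_abs_self b))
  have h1 := gaussKernel_sub_add_add_le_exp hh u d
  have h2 : Real.exp (-((1 - u ^ 2 / h ^ 2) / (2 * h ^ 2) * d ^ 2)) ≤ Real.exp (-(β * d ^ 2)) := by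
    rw [hβ]
    gcongr
  -- From `exp (-v) ≤ 1 / (1 + v) = 1 - v / (1 + v)`; the bound on `d` makes the gap proportional to
  -- `d ^ 2`.
  have h3 : Real.exp (-(β * d ^ 2)) ≤ 1 - β / (1 + β * b ^ 2) * d ^ 2 := by
    have hv : 0 ≤ β * d ^ 2 := by positivity
    have h4 : Real.exp (-(β * d ^ 2)) ≤ 1 / (1 + β * d ^ 2) := by
      rw [Real.exp_neg, ← one_div]
      gcongr
      linarith [Real.add_one_le_exp (β * d ^ 2)]
    have h5 : 1 / (1 + β * d ^ 2) = 1 - β / (1 + β * d ^ 2) * d ^ 2 := by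
      field_simp
      ring
    have h6 : β / (1 + β * b ^ 2) * d ^ 2 ≤ β / (1 + β * d ^ 2) * d ^ 2 := by
      gcongr
    linarith
  have hGu : gaussKernel h a ≤ gaussKernel h u :=
    gaussKernel_le_of_abs_le hh (by rwa [abs_of_nonneg ha0])
  have h7 : gaussKernel h a * (β / (1 + β * b ^ 2) * d ^ 2) ≤
      gaussKernel h u * (β / (1 + β * b ^ 2) * d ^ 2) := by gcongr
  have h8 : gaussKernel h u * Real.exp (-((1 - u ^ 2 / h ^ 2) / (2 * h ^ 2) * d ^ 2)) ≤
      gaussKernel h u * (1 - β / (1 + β * b ^ 2) * d ^ 2) :=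
    mul_le_mul_of_nonneg_left (h2.trans h3) (gaussKernel_pos hh u).le
  nlinarith

end Kernel

/-! ### Excess information error and variance -/

section Calibration

variable {X : Type*} [MeasurableSpace X] {ρ : Measure (X × ℝ)} {fstar : X → ℝ} {p : X → ℝ → ℝ}
  {h Mt : ℝ}

lemma informationError_add_const (f : X → ℝ) (b : ℝ) :
    informationError ρ h (fun x => f x + b) = informationError ρ h f := by
  simp only [informationError]
  congr 3
  funext z
  congr 1
  funext z'
  congr 1
  ring

lemma measurable_gaussKernel_residual {f : X → ℝ} (hf : Measurable f) :
    Measurable fun w : (X × ℝ) × X × ℝ =>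
      gaussKernel h ((w.1.2 - f w.1.1) - (w.2.2 - f w.2.1)) :=
  (continuous_gaussKernel h).measurable.comp (by fun_prop)

lemma IsNoiseDensity.ae_abs_sub_le (hfs : Measurable fstar)
    (hp : IsNoiseDensity ρ fstar p) (hsupp : ∀ x, Function.support (p x) ⊆ Icc (-Mt) Mt) :
    ∀ᵐ z ∂ρ, |z.2 - fstar z.1| ≤ Mt := by
  have hm : Measurable fun z : X × ℝ => (z.1, z.2 - fstar z.1) := by fun_prop
  have h1 : ∀ᵐ w ∂(ρ.map fun z : X × ℝ => (z.1, z.2 - fstar z.1)), |w.2| ≤ Mt := by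
    have hpm : Measurable fun w : X × ℝ => ENNReal.ofReal (p w.1 w.2) :=
      hp.measurable.ennreal_ofReal
    rw [hp.joint_law, ae_withDensity_iff hpm]
    refine ae_of_all _ fun w hw => abs_le.2 (hsupp w.1 fun h0 => hw ?_)
    rw [h0, ENNReal.ofReal_zero]
  exact ae_of_ae_map hm.aemeasurable h1

variable [IsProbabilityMeasure ρ]

/-- Passing from the response to the noise, `(x, y) ↦ (x, y - f x)`. -/
def noiseEquiv (f : X → ℝ) (hf : Measurable f) : X × ℝ ≃ᵐ X × ℝ where
  toFun z := (z.1, z.2 - f z.1)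
  invFun z := (z.1, z.2 + f z.1)
  left_inv z := by simp
  right_inv z := by simp
  measurable_toFun := by
    simp only [Equiv.coe_fn_mk]
    fun_prop
  measurable_invFun := by
    simp only [Equiv.coe_fn_symm_mk]
    fun_prop

/-- In the coordinates `(x, y - f* x)` the map is a sign change of the noise. It preserves the
product of the marginal and Lebesgue measure, and the density is even. -/
lemma IsNoiseDensity.measurePreserving_reflect (hfs : Measurable fstar)
    (hp : IsNoiseDensity ρ fstar p) (heven : ∀ x, Function.Even (p x)) :
    MeasurePreserving (fun z : X × ℝ => (z.1, 2 * fstar z.1 - z.2)) ρ ρ := by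
  set ν : Measure (X × ℝ) :=
    (ρ.fst.prod volume).withDensity (fun w => ENNReal.ofReal (p w.1 w.2)) with hν
  have hE : MeasurePreserving (noiseEquiv fstar hfs) ρ ν :=
    ⟨(noiseEquiv fstar hfs).measurable, hp.joint_law⟩
  have hneg0 : MeasurePreserving (Prod.map id Neg.neg : X × ℝ → X × ℝ)
      (ρ.fst.prod volume) (ρ.fst.prod volume) :=
    (MeasurePreserving.id _).prod (Measure.measurePreserving_neg volume)
  have hpm : Measurable fun w : X × ℝ => ENNReal.ofReal (p w.1 w.2) :=
    hp.measurable.ennreal_ofReal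
  have hneg : MeasurePreserving (Prod.map id Neg.neg : X × ℝ → X × ℝ) ν ν := by
    refine ⟨hneg0.measurable, Measure.ext fun s hs => ?_⟩
    rw [Measure.map_apply hneg0.measurable hs, hν, withDensity_apply _ hs,
      withDensity_apply _ (hneg0.measurable hs), ← hneg0.setLIntegral_comp_preimage hs hpm]
    simp only [Prod.map_fst, Prod.map_snd, id, (heven _) _]
  have := (hE.symm.comp hneg).comp hE
  convert this using 1
  funext z
  simp only [Function.comp, noiseEquiv, MeasurableEquiv.coe_mk, Equiv.coe_fn_mk,
    MeasurableEquiv.symm_mk, Equiv.coe_fn_symm_mk, Prod.map]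
  ext
  · rfl
  · simp
    ring

lemma informationError_eq (hh : 0 < h) {f : X → ℝ} (hf : Measurable f) :
    informationError ρ h f = -∫ w : (X × ℝ) × X × ℝ,
      gaussKernel h ((w.1.2 - f w.1.1) - (w.2.2 - f w.2.1)) ∂(ρ.prod ρ) := by
  rw [informationError, integral_prod]
  exact integrable_of_abs_le (measurable_gaussKernel_residual hf) fun _ => abs_gaussKernel_le hh _

/-- Twice the excess information error, symmetrized in the noise. -/
lemma two_mul_informationError_sub (hh : 0 < h) (hfs : Measurable fstar)
    (hp : IsNoiseDensity ρ fstar p) (heven : ∀ x, Function.Even (p x))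
    {f : X → ℝ} (hf : Measurable f) :
    2 * (informationError ρ h f - informationError ρ h fstar) =
      ∫ w : (X × ℝ) × X × ℝ, (2 * gaussKernel h ((w.1.2 - fstar w.1.1) - (w.2.2 - fstar w.2.1)) -
        (gaussKernel h (((w.1.2 - fstar w.1.1) - (w.2.2 - fstar w.2.1)) -
            ((f w.1.1 - fstar w.1.1) - (f w.2.1 - fstar w.2.1))) +
          gaussKernel h (((w.1.2 - fstar w.1.1) - (w.2.2 - fstar w.2.1)) +
            ((f w.1.1 - fstar w.1.1) - (f w.2.1 - fstar w.2.1))))) ∂(ρ.prod ρ) := by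
  have hT := hp.measurePreserving_reflect hfs heven
  have hTT := hT.prod hT
  have hint : ∀ {g : X → ℝ}, Measurable g → Integrable (fun w : (X × ℝ) × X × ℝ =>
      gaussKernel h ((w.1.2 - g w.1.1) - (w.2.2 - g w.2.1))) (ρ.prod ρ) := fun hg =>
    integrable_of_abs_le (measurable_gaussKernel_residual hg) fun _ => abs_gaussKernel_le hh _
  -- Reflecting both observations changes `u - d` into `-u - d`, and the kernel is even.
  have hflip : ∫ w : (X × ℝ) × X × ℝ, gaussKernel h ((w.1.2 - f w.1.1) - (w.2.2 - f w.2.1))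
      ∂(ρ.prod ρ) = ∫ w : (X × ℝ) × X × ℝ,
        gaussKernel h (((w.1.2 - fstar w.1.1) - (w.2.2 - fstar w.2.1)) +
            ((f w.1.1 - fstar w.1.1) - (f w.2.1 - fstar w.2.1))) ∂(ρ.prod ρ) := by
    conv_lhs => rw [← hTT.map_eq]
    rw [integral_map hTT.measurable.aemeasurable
      (measurable_gaussKernel_residual hf).aestronglyMeasurable]
    refine integral_congr_ae (ae_of_all _ fun w => ?_)
    simp only [Prod.map]
    rw [← gaussKernel_neg]
    congr 1
    ring
  have hsame : ∀ w : (X × ℝ) × X × ℝ,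
      gaussKernel h (((w.1.2 - fstar w.1.1) - (w.2.2 - fstar w.2.1)) -
            ((f w.1.1 - fstar w.1.1) - (f w.2.1 - fstar w.2.1))) =
        gaussKernel h ((w.1.2 - f w.1.1) - (w.2.2 - f w.2.1)) := fun w => by
    congr 1; ring
  have hint2 : Integrable (fun w : (X × ℝ) × X × ℝ =>
      gaussKernel h (((w.1.2 - fstar w.1.1) - (w.2.2 - fstar w.2.1)) +
            ((f w.1.1 - fstar w.1.1) - (f w.2.1 - fstar w.2.1)))) (ρ.prod ρ) :=
    integrable_of_abs_le ((continuous_gaussKernel h).measurable.comp (by fun_prop))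
      fun _ => abs_gaussKernel_le hh _
  simp only [hsame]
  rw [integral_sub ((hint hfs).const_mul 2) ((hint hf).fun_add hint2), integral_const_mul,
    integral_add (hint hf) hint2, ← hflip, informationError_eq hh hf, informationError_eq hh hfs]
  ring

/-- The regression function, up to a constant, minimizes the information error. -/
theorem isMinOn_informationError (hMt : 0 < Mt) (hh : 2 * Mt ≤ h) (hfs : Measurable fstar)
    (hp : IsNoiseDensity ρ fstar p) (hP2 : SymmetricBoundedNoise p Mt) (b : ℝ) :
    IsMinOn (informationError ρ h) {f | Measurable f} (fun x => fstar x + b) := by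
  intro f hf
  rw [mem_ofPred_eq, informationError_add_const]
  have hh0 : 0 < h := by linarith
  have h1 := two_mul_informationError_sub hh0 hfs hp hP2.2.1 (f := f) hf
  have hae := hp.ae_abs_sub_le hfs hP2.2.2
  have h2 := integral_nonneg_of_ae (μ := ρ.prod ρ) (f := fun w : (X × ℝ) × X × ℝ =>
      (2 * gaussKernel h ((w.1.2 - fstar w.1.1) - (w.2.2 - fstar w.2.1)) -
        (gaussKernel h (((w.1.2 - fstar w.1.1) - (w.2.2 - fstar w.2.1)) -
            ((f w.1.1 - fstar w.1.1) - (f w.2.1 - fstar w.2.1))) +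
          gaussKernel h (((w.1.2 - fstar w.1.1) - (w.2.2 - fstar w.2.1)) +
            ((f w.1.1 - fstar w.1.1) - (f w.2.1 - fstar w.2.1)))))) <| by
    filter_upwards [Measure.quasiMeasurePreserving_fst.ae hae,
      Measure.quasiMeasurePreserving_snd.ae hae] with w hw1 hw2
    refine sub_nonneg.2 (gaussKernel_sub_add_add_le hh0 ?_ _)
    refine (abs_sub _ _).trans ?_
    linarith
  linarith

/-- Expand around the mean `m`: the cross term vanishes by centring, and the two squares contribute
equally. -/
lemma integral_prod_sub_sq (μ : Measure (X × ℝ)) [IsProbabilityMeasure μ] {g : X → ℝ}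
    (hg : Measurable g) {B : ℝ} (hB : ∀ x, |g x| ≤ B) :
    ∫ w : (X × ℝ) × X × ℝ, (g w.1.1 - g w.2.1) ^ 2 ∂(μ.prod μ) =
      2 * ∫ x, (g x - ∫ u, g u ∂μ.fst) ^ 2 ∂μ.fst := by
  have hfst : ∀ {φ : X → ℝ}, Measurable φ → ∫ x, φ x ∂μ.fst = ∫ z, φ z.1 ∂μ := fun hφ =>
    integral_map measurable_fst.aemeasurable hφ.aestronglyMeasurable
  set m := ∫ u, g u ∂μ.fst with hm
  have hB0 : ∀ x, |g x| ≤ |B| := fun x => (hB x).trans (le_abs_self B)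
  have hgi : Integrable (fun z : X × ℝ => g z.1) μ :=
    integrable_of_abs_le (by fun_prop) fun z => hB z.1
  have hgm : Measurable fun x => g x - m := hg.sub_const m
  have hk : ∀ x, |g x - m| ≤ |B| + |m| := fun x => (abs_sub _ _).trans (add_le_add_left (hB0 x) _)
  have hki : Integrable (fun z : X × ℝ => g z.1 - m) μ :=
    integrable_of_abs_le (by fun_prop) fun z => hk z.1
  have hk2i : Integrable (fun z : X × ℝ => (g z.1 - m) ^ 2) μ :=
    integrable_of_abs_le (B := (|B| + |m|) ^ 2) (by fun_prop) fun z => by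
      rw [abs_pow]; gcongr; exact hk z.1
  have hzero : ∫ z, (g z.1 - m) ∂μ = 0 := by
    rw [integral_sub hgi (integrable_const _), hm, hfst hg]
    simp
  have hint : Integrable (fun w : (X × ℝ) × X × ℝ => (g w.1.1 - g w.2.1) ^ 2) (μ.prod μ) :=
    integrable_of_abs_le (B := (|B| + |B|) ^ 2) (by fun_prop) fun w => by
      rw [abs_pow]
      gcongr
      exact (abs_sub _ _).trans (add_le_add (hB0 _) (hB0 _))
  rw [integral_prod _ hint, hfst (hgm.pow_const 2)]
  have hinner : ∀ z : X × ℝ, ∫ z', (g z.1 - g z'.1) ^ 2 ∂μ =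
      (g z.1 - m) ^ 2 + ∫ z', (g z'.1 - m) ^ 2 ∂μ := by
    intro z
    have e : ∀ z' : X × ℝ, (g z.1 - g z'.1) ^ 2 =
        (g z.1 - m) ^ 2 + (g z'.1 - m) ^ 2 - 2 * (g z.1 - m) * (g z'.1 - m) := fun z' => by ring
    simp only [e]
    rw [integral_sub ((integrable_const _).fun_add hk2i) (hki.const_mul _),
      integral_add (integrable_const _) hk2i, integral_const_mul, hzero]
    simp
  simp only [hinner]
  rw [integral_add hk2i (integrable_const _)]
  simp
  ring

/-- The excess information error controls the variance of `f - f*`. -/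
theorem exists_adjustedErrorSq_le (hMt : 0 < Mt) (hh : 2 * Mt < h) (hfs : Measurable fstar)
    (hp : IsNoiseDensity ρ fstar p) (hP2 : SymmetricBoundedNoise p Mt) {M : ℝ}
    (hfsM : ∀ x, |fstar x| ≤ M) :
    ∃ κ : ℝ, 0 < κ ∧ ∀ f : X → ℝ, Measurable f → (∀ x, |f x| ≤ M) →
      κ * adjustedErrorSq ρ.fst fstar f ≤ informationError ρ h f - informationError ρ h fstar := by
  have hh0 : 0 < h := by linarith
  -- Two noises differ by at most `2 Mt`, and two values of `f - f*`, each bounded by `2 M`, by at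
  -- most `4 M`.
  obtain ⟨κ, hκ, H⟩ := exists_le_gaussKernel_sub hh0 (a := 2 * Mt) (b := 4 * M) (by linarith) hh
  refine ⟨κ, hκ, fun f hf hfM => ?_⟩
  have h1 := two_mul_informationError_sub hh0 hfs hp hP2.2.1 hf
  have hae := hp.ae_abs_sub_le hfs hP2.2.2
  have hdM : ∀ x, |f x - fstar x| ≤ 2 * M := fun x =>
    (abs_sub _ _).trans (by linarith [hfM x, hfsM x])
  have hadj : adjustedErrorSq ρ.fst fstar f =
      ∫ x, ((f x - fstar x) - ∫ u, (f u - fstar u) ∂ρ.fst) ^ 2 ∂ρ.fst := by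
    have e : ∫ u, (fstar u - f u) ∂ρ.fst = -∫ u, (f u - fstar u) ∂ρ.fst := by
      rw [← integral_neg]
      simp
    simp only [adjustedErrorSq, e]
    congr 1
    funext x
    ring
  have h2 := integral_prod_sub_sq ρ (g := fun x => f x - fstar x) (hf.sub hfs) hdM
  have hmono : ∫ w : (X × ℝ) × X × ℝ,
      κ * ((f w.1.1 - fstar w.1.1) - (f w.2.1 - fstar w.2.1)) ^ 2 ∂(ρ.prod ρ) ≤
      2 * (informationError ρ h f - informationError ρ h fstar) := by
    rw [h1]
    refine integral_mono_ae ?_ ?_ ?_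
    · refine integrable_of_abs_le (B := κ * (2 * M + 2 * M) ^ 2) (by fun_prop) fun w => ?_
      rw [abs_mul, abs_of_pos hκ, abs_pow]
      gcongr
      exact (abs_sub _ _).trans (add_le_add (hdM _) (hdM _))
    · have hi : ∀ {φ : (X × ℝ) × X × ℝ → ℝ}, Measurable φ →
          Integrable (fun w => gaussKernel h (φ w)) (ρ.prod ρ) := fun hφ =>
        integrable_of_abs_le ((continuous_gaussKernel h).measurable.comp hφ)
          fun _ => abs_gaussKernel_le hh0 _
      exact ((hi (by fun_prop)).const_mul 2).sub ((hi (by fun_prop)).add (hi (by fun_prop)))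
    · filter_upwards [Measure.quasiMeasurePreserving_fst.ae hae,
        Measure.quasiMeasurePreserving_snd.ae hae] with w hw1 hw2
      refine H _ _ ((abs_sub _ _).trans (by linarith)) ((abs_sub _ _).trans ?_)
      linarith [hdM w.1.1, hdM w.2.1]
  rw [integral_const_mul, h2, ← hadj] at hmono
  linarith

end Calibration

/-! ### Entropy of the kernel class over translates -/

section Covering

variable {X : Type*} {n : ℕ}

lemma exists_finset_of_empiricalCoveringNumber {H : Set (X → ℝ)} (hH : H.Nonempty) {ε : ℝ≥0}
    (htop : empiricalCoveringNumber H ε ≠ ⊤) {b : ℝ}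
    (hb : Real.log ((empiricalCoveringNumber H ε).toNat : ℝ) ≤ b) (hn : 1 ≤ n) (x : Fin n → X) :
    ∃ C : Finset (Fin n → ℝ), (C.card : ℝ) ≤ Real.exp b ∧
      ∀ f ∈ H, ∃ u ∈ C, ∑ i, (f (x i) - u i) ^ 2 ≤ n * (ε : ℝ) ^ 2 := by
  classical
  set A : Set (EuclideanSpace ℝ (Fin n)) :=
    (fun f : X → ℝ => (WithLp.toLp 2 (fun i => f (x i)) : EuclideanSpace ℝ (Fin n))) '' H with hA
  have hle : Metric.externalCoveringNumber (ε * NNReal.sqrt n) A ≤ empiricalCoveringNumber H ε :=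
    le_iSup₂_of_le n hn (le_iSup_of_le x le_rfl)
  -- The covering number is an infimum; a strict bound by a finite number plus one yields an actual
  -- cover of the required size.
  have hlt : Metric.externalCoveringNumber (ε * NNReal.sqrt n) A <
      empiricalCoveringNumber H ε + 1 :=
    hle.trans_lt ((ENat.lt_add_one_iff htop).2 le_rfl)
  rw [Metric.externalCoveringNumber] at hlt
  simp only [iInf_lt_iff] at hlt
  obtain ⟨C, hC, hCcard⟩ := hlt
  rw [ENat.lt_add_one_iff htop] at hCcard
  have hCfin : C.Finite := Set.encard_ne_top_iff.1 (ne_top_of_le_ne_top htop hCcard)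
  have hcov : ∀ f ∈ H, ∃ u ∈ C, ∑ i, (f (x i) - u i) ^ 2 ≤ n * (ε : ℝ) ^ 2 := by
    intro f hf
    obtain ⟨u, hu, hdist⟩ := hC (mem_image_of_mem _ hf)
    refine ⟨u, hu, ?_⟩
    have h1 : dist (WithLp.toLp 2 (fun i => f (x i)) : EuclideanSpace ℝ (Fin n)) u ≤
        (ε * NNReal.sqrt n : ℝ≥0) := by
      rw [dist_nndist, NNReal.coe_le_coe, ← ENNReal.coe_le_coe, ← edist_nndist]
      exact hdist
    rw [EuclideanSpace.dist_eq] at h1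
    have h2 := (Real.sqrt_le_left (by positivity)).1 h1
    simp only [Real.dist_eq, sq_abs] at h2
    refine h2.trans (le_of_eq ?_)
    rw [NNReal.coe_mul, mul_pow, Real.coe_sqrt, NNReal.coe_natCast,
      Real.sq_sqrt (Nat.cast_nonneg n), mul_comm]
  refine ⟨hCfin.toFinset.image fun u i => u i, ?_, fun f hf => ?_⟩
  · obtain ⟨f, hf⟩ := hH
    obtain ⟨u, hu, -⟩ := hcov f hf
    have h1 : hCfin.toFinset.card ≤ (empiricalCoveringNumber H ε).toNat := by
      rw [← ENat.natCast_le_natCast, ENat.natCast_toNat htop, ← hCfin.encard_eq_coe_toFinset_card]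
      exact hCcard
    have h2 : 0 < hCfin.toFinset.card :=
      Finset.card_pos.2 ⟨u, hCfin.mem_toFinset.2 hu⟩
    have h3 : (0 : ℝ) < (empiricalCoveringNumber H ε).toNat := by exact_mod_cast h2.trans_le h1
    calc ((hCfin.toFinset.image fun u i => u i).card : ℝ) ≤ hCfin.toFinset.card := by
          exact_mod_cast Finset.card_image_le
      _ ≤ (empiricalCoveringNumber H ε).toNat := by exact_mod_cast h1
      _ ≤ Real.exp b := (Real.log_le_iff_le_exp h3).1 hb
  · obtain ⟨u, hu, h⟩ := hcov f hf
    exact ⟨fun i => u i, Finset.mem_image.2 ⟨u, hCfin.mem_toFinset.2 hu, rfl⟩, h⟩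

/-- The translates `f + t` with `f ∈ H` and `|t| ≤ R`. -/
def translates (H : Set (X → ℝ)) (R : ℝ) : Set (X → ℝ) :=
  {u | ∃ f ∈ H, ∃ t : ℝ, |t| ≤ R ∧ u = fun x => f x + t}

lemma rpow_neg_inv_two_pow (s : ℝ) (k : ℕ) : (((2 : ℝ) ^ k)⁻¹) ^ (-s) = ((2 : ℝ) ^ s) ^ k := by
  rw [Real.inv_rpow (by positivity), Real.rpow_neg (by positivity), inv_inv,
    ← Real.rpow_natCast, ← Real.rpow_natCast, ← Real.rpow_mul (by norm_num),
    ← Real.rpow_mul (by norm_num), mul_comm]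

/-- Exponential moments of the signed means of the kernel at the residuals of translates of `H`,
under the polynomial entropy bound of exponent less than `2`. -/
theorem exists_signAverage_gaussKernel_le {H : Set (X → ℝ)} (hne : H.Nonempty) {c s : ℝ}
    (hc : 0 < c) (hs : s < 2)
    (hcov : ∀ ε : ℝ≥0, 0 < ε → empiricalCoveringNumber H ε ≠ ⊤ ∧
      Real.log ((empiricalCoveringNumber H ε).toNat : ℝ) ≤ c * (ε : ℝ) ^ (-s))
    {h : ℝ} (hh : 0 < h) {R : ℝ} (hR : 0 ≤ R) :
    ∃ κ : ℝ, 0 < κ ∧ ∀ n : ℕ, 1 ≤ n → ∀ (z : Fin n → X × ℝ) (u : (Fin n → Bool) → X → ℝ),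
      (∀ σ, u σ ∈ translates H R) → ∀ lam : ℝ, 0 ≤ lam →
      signAverage (fun σ => Real.exp (lam * signedMean σ fun i =>
        gaussKernel h ((z i).2 - u σ (z i).1))) ≤ Real.exp (2 + κ * (lam ^ 2 / n)) := by
  classical
  set B := gaussKernel h 0 with hB
  have hB0 : 0 < B := gaussKernel_pos hh 0
  set l := B / h with hl
  have hl0 : 0 < l := by positivity
  -- `B` bounds the kernel at level zero; `2 * l` absorbs the errors in `f` and in the shift, each
  -- at most `2 ^ (-k)`, scaled by the Lipschitz constant `l`.
  set L := B + 2 * l with hL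
  -- `2 ^ s` is the entropy growth of `H` per dyadic level and `2` that of the grid of shifts; `s <
  -- 2` keeps `τ` below 4.
  set τ : ℝ := max 2 (2 ^ s) with hτ
  have hτ2 : 2 ≤ τ := le_max_left _ _
  have hτ4 : τ < 4 := by
    refine max_lt (by norm_num) ?_
    calc (2 : ℝ) ^ s < 2 ^ (2 : ℝ) := Real.rpow_lt_rpow_of_exponent_lt (by norm_num) hs
      _ = 4 := by norm_num
  set c' : ℝ := c + (2 * R + 3) with hc'
  have hsq : √τ / 2 < 1 := by
    rw [div_lt_one (by norm_num), Real.sqrt_lt' (by norm_num)]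
    linarith
  have h1q : 0 < 1 - √τ / 2 := by linarith
  refine ⟨5 / 4 * (1 + 5 * c') * L ^ 2 / (1 - √τ / 2) ^ 2, by positivity,
    fun n hn z u hu lam hlam => ?_⟩
  refine signAverage_exp_le_of_cover hn (by positivity) (by positivity) (by linarith) hτ4
    {v | ∃ w ∈ translates H R, v = fun i => gaussKernel h ((z i).2 - w (z i).1)} ?_ ?_ hlam _
    fun σ => ⟨u σ, hu σ, rfl⟩
  · rintro v ⟨w, -, rfl⟩
    calc ∑ i, gaussKernel h ((z i).2 - w (z i).1) ^ 2 ≤ ∑ _i : Fin n, L ^ 2 := by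
          refine Finset.sum_le_sum fun i _ => pow_le_pow_left₀ (gaussKernel_pos hh _).le ?_ 2
          exact (gaussKernel_le hh _).trans (by linarith)
      _ = n * L ^ 2 := by simp
  · intro k _
    obtain ⟨htop, hlog⟩ := hcov ((2 ^ k)⁻¹) (by positivity)
    obtain ⟨C, hCcard, hC⟩ :=
      exists_finset_of_empiricalCoveringNumber hne htop hlog hn fun i => (z i).1
    -- The shifts in `[-R, R]` are rounded down to the grid of mesh `2 ^ (-k)`, and `m` grid points
    -- on each side of zero are enough.
    set m : ℕ := ⌈R * 2 ^ k⌉₊ with hm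
    refine ⟨(C ×ˢ Finset.Icc (-(m : ℤ)) m).image fun q i =>
      gaussKernel h ((z i).2 - (q.1 i + (q.2 : ℝ) / 2 ^ k)), ?_, ?_⟩
    · have h1 : ((C ×ˢ Finset.Icc (-(m : ℤ)) m).card : ℝ) = C.card * (2 * m + 1) := by
        rw [Finset.card_product, Int.card_Icc]
        have : ((m : ℤ) + 1 - -(m : ℤ)).toNat = 2 * m + 1 := by omega
        rw [this]
        push_cast
        ring
      have h2k : (1 : ℝ) ≤ 2 ^ k := one_le_pow₀ (by norm_num)
      have h2 : (2 * m + 1 : ℝ) ≤ (2 * R + 3) * τ ^ k := by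
        have h3 : (m : ℝ) ≤ R * 2 ^ k + 1 := (Nat.ceil_lt_add_one (by positivity)).le
        have h4 : (2 : ℝ) ^ k ≤ τ ^ k := pow_le_pow_left₀ (by norm_num) hτ2 k
        nlinarith
      have h3 : (C.card : ℝ) ≤ Real.exp (c * τ ^ k) := by
        refine hCcard.trans (Real.exp_le_exp.2 (mul_le_mul_of_nonneg_left ?_ hc.le))
        push_cast
        rw [rpow_neg_inv_two_pow]
        exact pow_le_pow_left₀ (by positivity) (le_max_right _ _) k
      calc _ ≤ ((C ×ˢ Finset.Icc (-(m : ℤ)) m).card : ℝ) := by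
            exact_mod_cast Finset.card_image_le
        _ = C.card * (2 * m + 1) := h1
        _ ≤ Real.exp (c * τ ^ k) * Real.exp ((2 * R + 3) * τ ^ k) := by
            gcongr
            exact h2.trans (by linarith [Real.add_one_le_exp ((2 * R + 3) * τ ^ k)])
        _ = _ := by
            rw [← Real.exp_add]
            congr 1
            ring
    · rintro v ⟨w, ⟨f, hf, t, ht, rfl⟩, rfl⟩
      obtain ⟨q, hq, hqd⟩ := hC f hf
      have h2k : (0 : ℝ) < 2 ^ k := by positivity
      have ht' := abs_le.1 ht
      set a : ℤ := ⌊t * 2 ^ k⌋ with ha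
      have ha1 : (a : ℝ) ≤ t * 2 ^ k := Int.floor_le _
      have ha2 : t * 2 ^ k < a + 1 := Int.lt_floor_add_one _
      have hmR : R * 2 ^ k ≤ m := Nat.le_ceil _
      have hat : (t - a / 2 ^ k) ^ 2 ≤ ((2 ^ k)⁻¹ : ℝ) ^ 2 := by
        have e : t - a / 2 ^ k = (t * 2 ^ k - a) * (2 ^ k)⁻¹ := by field_simp
        rw [e, mul_pow]
        refine mul_le_of_le_one_left (by positivity) ?_
        nlinarith
      refine ⟨_, Finset.mem_image.2 ⟨(q, a), Finset.mem_product.2 ⟨hq, Finset.mem_Icc.2 ⟨?_, ?_⟩⟩,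
        rfl⟩, ?_⟩
      · rw [ha, Int.le_floor]
        push_cast
        nlinarith
      · have : (a : ℝ) ≤ m := by nlinarith
        exact_mod_cast this
      · push_cast at hqd
        have hpt : ∀ i, (gaussKernel h ((z i).2 - (f (z i).1 + t)) -
            gaussKernel h ((z i).2 - (q i + (a : ℝ) / 2 ^ k))) ^ 2 ≤
            2 * l ^ 2 * (f (z i).1 - q i) ^ 2 + 2 * l ^ 2 * ((2 ^ k)⁻¹) ^ 2 := by
          intro i
          have h1 := gaussKernel_lipschitz hh ((z i).2 - (f (z i).1 + t))
            ((z i).2 - (q i + (a : ℝ) / 2 ^ k))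
          have h2 : (gaussKernel h ((z i).2 - (f (z i).1 + t)) -
            gaussKernel h ((z i).2 - (q i + (a : ℝ) / 2 ^ k))) ^ 2 ≤
              (l * |((z i).2 - (f (z i).1 + t)) - ((z i).2 - (q i + (a : ℝ) / 2 ^ k))|) ^ 2 :=
            sq_le_sq.2 (h1.trans (le_abs_self _))
          rw [mul_pow, sq_abs] at h2
          refine h2.trans ?_
          have e : (((z i).2 - (f (z i).1 + t)) - ((z i).2 - (q i + (a : ℝ) / 2 ^ k))) ^ 2 ≤
              2 * (f (z i).1 - q i) ^ 2 + 2 * (t - a / 2 ^ k) ^ 2 := by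
            nlinarith [sq_nonneg ((f (z i).1 - q i) - (t - a / 2 ^ k))]
          calc l ^ 2 * _ ≤ l ^ 2 * (2 * (f (z i).1 - q i) ^ 2 + 2 * ((2 ^ k)⁻¹) ^ 2) := by
                gcongr
                linarith
            _ = _ := by ring
        refine (Finset.sum_le_sum fun i _ => hpt i).trans ?_
        rw [Finset.sum_add_distrib, ← Finset.mul_sum]
        calc _ ≤ 2 * l ^ 2 * (n * ((2 ^ k)⁻¹) ^ 2) + ∑ _i : Fin n, 2 * l ^ 2 * ((2 ^ k)⁻¹) ^ 2 := by
              gcongr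
          _ = n * (2 * l * (2 ^ k)⁻¹) ^ 2 := by
              simp
              ring
          _ ≤ n * (L / 2 ^ k) ^ 2 := by
              rw [div_eq_mul_inv]
              gcongr
              linarith

end Covering

/-! ### From finite classes to classes of continuous functions -/

section Countable

variable {Ω : Type*} [PseudoMetricSpace Ω] [MeasurableSpace Ω] {n : ℕ}

/-- A bound on the probability that an empirical process is large, uniform over finite classes,
extends to any class of continuous functions when the law is concentrated on a separable set. -/
theorem measure_exists_lt_abs_sampleMean_sub_le (P : Measure Ω) [IsProbabilityMeasure P]
    {S : Set Ω} (hS : TopologicalSpace.IsSeparable S) (hPS : ∀ᵐ ω ∂P, ω ∈ S)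
    (F : Set (Ω → ℝ)) (hF : ∀ φ ∈ F, Continuous φ) {t : ℝ} {b : ℝ≥0∞}
    (hfin : ∀ T ⊆ F, T.Finite → (Measure.pi fun _ : Fin n => P)
      {z | ∃ φ ∈ T, t < |sampleMean φ z - ∫ ω, φ ω ∂P|} ≤ b) :
    (Measure.pi fun _ : Fin n => P)
      {z | ∃ φ ∈ F, t < |sampleMean φ z - ∫ ω, φ ω ∂P|} ≤ b := by
  have := hS.separableSpace
  have : SecondCountableTopology S := UniformSpace.secondCountable_of_separable S
  let E : (Ω → ℝ) → Set (Fin n → Ω) := fun φ => {z | t < |sampleMean φ z - ∫ ω, φ ω ∂P|}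
  let D : F → Set (Fin n → S) := fun φ => (fun w i => (w i : Ω)) ⁻¹' E φ
  have hopen : ∀ φ, IsOpen (D φ) := by
    intro φ
    have hc : Continuous (φ : Ω → ℝ) := hF φ φ.2
    have h1 : Continuous fun w : Fin n → S =>
        |sampleMean (φ : Ω → ℝ) (fun i => (w i : Ω)) - ∫ ω, (φ : Ω → ℝ) ω ∂P| := by
      unfold sampleMean
      fun_prop
    exact isOpen_lt continuous_const h1
  -- For continuous `φ` the event is open in the second countable space `Fin n → S`, so the Lindelöf
  -- property leaves a countable subfamily with the same union.
  obtain ⟨T, hT, hTU⟩ := TopologicalSpace.isOpen_iUnion_countable D hopen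
  have hae : ∀ᵐ z ∂(Measure.pi fun _ : Fin n => P), ∀ i, z i ∈ S := by
    rw [ae_all_iff]
    exact fun i => (measurePreserving_eval (fun _ : Fin n => P) i).quasiMeasurePreserving.ae hPS
  have hsub : (Measure.pi fun _ : Fin n => P) {z | ∃ φ ∈ F, z ∈ E φ} ≤
      (Measure.pi fun _ : Fin n => P) (⋃ φ ∈ T, E φ) := by
    refine measure_mono_ae ?_
    filter_upwards [hae] with z hz
    rintro ⟨φ, hφ, hzφ⟩
    have h1 : (fun i => (⟨z i, hz i⟩ : S)) ∈ ⋃ φ, D φ := mem_iUnion.2 ⟨⟨φ, hφ⟩, hzφ⟩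
    rw [← hTU, mem_iUnion₂] at h1
    obtain ⟨ψ, hψ, hz'⟩ := h1
    exact mem_iUnion₂.2 ⟨ψ, hψ, hz'⟩
  refine hsub.trans ?_
  rcases T.eq_empty_or_nonempty with rfl | hne
  · simp
  obtain ⟨f, rfl⟩ := hT.exists_eq_range hne
  -- The countable union is an increasing limit of finite ones, each bounded by `b`.
  rw [biUnion_range, measure_iUnion_eq_iSup_accumulate]
  refine iSup_le fun k => ?_
  refine (measure_mono ?_).trans (hfin ((fun j => (f j : Ω → ℝ)) '' Iic k) ?_
    ((finite_Iic k).image _))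
  · intro z hz
    obtain ⟨j, hj, hz⟩ := mem_iUnion₂.1 hz
    exact ⟨_, mem_image_of_mem _ hj, hz⟩
  · rintro _ ⟨j, -, rfl⟩
    exact (f j).2

end Countable

/-! ### Uniform deviations and the learning rate -/

section Deviation

variable {X : Type*} [MetricSpace X] [MeasurableSpace X] [BorelSpace X] {ρ : Measure (X × ℝ)}
  [IsProbabilityMeasure ρ] {H : Set (X → ℝ)} {h : ℝ}

/-- The kernel at the residual `y - u x`. -/
noncomputable def residualKernel (h : ℝ) (u : X → ℝ) (w : X × ℝ) : ℝ :=
  gaussKernel h (w.2 - u w.1)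

omit [MeasurableSpace X] [BorelSpace X] in
lemma continuous_residualKernel (h : ℝ) {u : X → ℝ} (hu : Continuous u) :
    Continuous (residualKernel h u) :=
  (continuous_gaussKernel h).comp (by fun_prop)

/-- Uniform deviation of the empirical means of `residualKernel` over the translates of `H`. -/
theorem exists_measure_uniform_deviation_le
    (hsep : ∃ S : Set X, TopologicalSpace.IsSeparable S ∧ ∀ᵐ x ∂ρ.fst, x ∈ S)
    (hne : H.Nonempty) (hcont : ∀ f ∈ H, Continuous f) {c s : ℝ} (hc : 0 < c) (hs : s < 2)
    (hcov : ∀ ε : ℝ≥0, 0 < ε → empiricalCoveringNumber H ε ≠ ⊤ ∧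
      Real.log ((empiricalCoveringNumber H ε).toNat : ℝ) ≤ c * (ε : ℝ) ^ (-s))
    (hh : 0 < h) {R : ℝ} (hR : 0 ≤ R) :
    ∃ κ : ℝ, 0 < κ ∧ ∀ n : ℕ, 1 ≤ n → ∀ t : ℝ, 0 ≤ t →
      (Measure.pi fun _ : Fin n => ρ) {z | ∃ u ∈ translates H R,
        t < |sampleMean (residualKernel h u) z - ∫ w, residualKernel h u w ∂ρ|} ≤
      ENNReal.ofReal (2 * Real.exp (2 - t ^ 2 * n / (16 * κ))) := by
  obtain ⟨κ, hκ, hexp⟩ := exists_signAverage_gaussKernel_le hne hc hs hcov hh hR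
  refine ⟨κ, hκ, fun n hn t ht => ?_⟩
  obtain ⟨S, hS, hρS⟩ := hsep
  have hcontU : ∀ u ∈ translates H R, Continuous u := by
    rintro _ ⟨f, hf, a, -, rfl⟩
    exact (hcont f hf).add continuous_const
  have hmeas : ∀ u ∈ translates H R, Measurable (residualKernel h u) := fun u hu =>
    (continuous_gaussKernel h).measurable.comp
      (measurable_snd.sub ((hcontU u hu).measurable.comp measurable_fst))
  have hbd : ∀ u w, |residualKernel (X := X) h u w| ≤ gaussKernel h 0 := fun u w =>
    abs_gaussKernel_le hh _
  have hmain := measure_exists_lt_abs_sampleMean_sub_le (n := n) ρ (S := S ×ˢ univ)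
    (hS.prod (TopologicalSpace.IsSeparable.of_separableSpace univ))
    (by
      filter_upwards [ae_of_ae_map (f := Prod.fst) measurable_fst.aemeasurable hρS] with w hw
      exact ⟨hw, mem_univ _⟩)
    (residualKernel h '' translates H R)
    (by
      rintro _ ⟨u, hu, rfl⟩
      exact continuous_residualKernel h (hcontU u hu))
    (t := t) (b := ENNReal.ofReal (2 * Real.exp (2 - t ^ 2 * n / (16 * κ)))) ?_
  · simpa only [exists_mem_image] using hmain
  intro T hT hTfin
  have : Finite T := hTfin
  have hsel : ∀ φ : T, ∃ u ∈ translates H R, residualKernel h u = φ := fun φ => hT φ.2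
  choose U hU hUφ using hsel
  have hTm : ∀ φ : T, Measurable (φ : X × ℝ → ℝ) := fun φ => hUφ φ ▸ hmeas _ (hU φ)
  have hTb : ∀ (φ : T) w, |(φ : X × ℝ → ℝ) w| ≤ gaussKernel h 0 := fun φ w => by
    rw [← hUφ φ]
    exact hbd _ _
  have hTe : ∀ (z : Fin n → X × ℝ) (θ : (Fin n → Bool) → T) (lam : ℝ), 0 ≤ lam →
      signAverage (fun σ => Real.exp (lam * signedMean σ fun i => (θ σ : X × ℝ → ℝ) (z i))) ≤
        Real.exp (2 + κ * (lam ^ 2 / n)) := fun z θ lam hlam => by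
    have := hexp n hn z (fun σ => U (θ σ)) (fun σ => hU _) lam hlam
    simp only [← hUφ]
    exact this
  have h1 := measure_exists_lt_sampleMean_le ρ hn (fun (φ : T) w => (φ : X × ℝ → ℝ) w) hTm hTb hκ
    hTe ht
  -- The lower tail is the upper tail of the negated class; negation flips all signs, which leaves
  -- the sign average unchanged.
  have h2 := measure_exists_lt_sampleMean_le ρ hn (fun (φ : T) w => -(φ : X × ℝ → ℝ) w)
    (fun φ => (hTm φ).neg) (fun φ w => by rw [abs_neg]; exact hTb φ w) hκ
    (fun z θ lam hlam => by
      have h3 := hTe z (fun σ => θ fun i => !σ i) lam hlam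
      rw [← signAverage_not] at h3
      simp only [Bool.not_not, signedMean_not] at h3
      simpa only [signedMean_neg] using h3) ht
  calc _ ≤ (Measure.pi fun _ : Fin n => ρ) ({z | ∃ φ : T, t < sampleMean (fun w =>
            (φ : X × ℝ → ℝ) w) z - ∫ w, (φ : X × ℝ → ℝ) w ∂ρ} ∪
          {z | ∃ φ : T, t < sampleMean (fun w => -(φ : X × ℝ → ℝ) w) z -
            ∫ w, -(φ : X × ℝ → ℝ) w ∂ρ}) := by
        refine measure_mono ?_
        rintro z ⟨φ, hφ, hlt⟩
        rcases lt_abs.1 hlt with hlt | hlt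
        · exact Or.inl ⟨⟨φ, hφ⟩, hlt⟩
        · refine Or.inr ⟨⟨φ, hφ⟩, ?_⟩
          have e : sampleMean (fun w => -φ w) z = -sampleMean φ z := by
            simp [sampleMean, neg_div]
          rw [integral_neg]
          simp only [e]
          linarith
    _ ≤ _ := measure_union_le _ _
    _ ≤ _ := add_le_add h1 h2
    _ = _ := by
        rw [← ENNReal.ofReal_add (by positivity) (by positivity), two_mul]

/-- The empirical counterpart of `-informationError`. -/
noncomputable def empiricalPotential (h : ℝ) {n : ℕ} (z : Fin n → X × ℝ) (f : X → ℝ) : ℝ :=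
  1 / (n : ℝ) ^ 2 * ∑ i : Fin n, ∑ j : Fin n,
    gaussKernel h (((z i).2 - f (z i).1) - ((z j).2 - f (z j).1))

omit [MetricSpace X] [MeasurableSpace X] [BorelSpace X] in
lemma empiricalPotential_pos (hh : 0 < h) {n : ℕ} (hn : 1 ≤ n) (z : Fin n → X × ℝ) (f : X → ℝ) :
    0 < empiricalPotential h z f := by
  have : Nonempty (Fin n) := ⟨⟨0, hn⟩⟩
  have hn' : (0 : ℝ) < n := by exact_mod_cast hn
  refine mul_pos (by positivity) (Finset.sum_pos (fun i _ => Finset.sum_pos (fun j _ =>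
    gaussKernel_pos hh _) Finset.univ_nonempty) Finset.univ_nonempty)

omit [MetricSpace X] [BorelSpace X] in
/-- Fixing one residual as a shift reduces the double sum to empirical means. -/
lemma abs_empiricalPotential_add_informationError_le (hh : 0 < h) {n : ℕ} (hn : 1 ≤ n)
    {f : X → ℝ} (hf : f ∈ H) (hfm : Measurable f) {R t : ℝ}
    (hae : ∀ᵐ w ∂ρ, |w.2 - f w.1| ≤ R) {z : Fin n → X × ℝ} (hz : ∀ i, |(z i).2 - f (z i).1| ≤ R)
    (hdev : ∀ u ∈ translates H R,
      |sampleMean (residualKernel h u) z - ∫ w, residualKernel h u w ∂ρ| ≤ t) :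
    |empiricalPotential h z f + informationError ρ h f| ≤ 2 * t := by
  have hn' : (0 : ℝ) < n := by exact_mod_cast hn
  let e : X × ℝ → ℝ := fun w => w.2 - f w.1
  have hem : Measurable e := by fun_prop
  have hdev' : ∀ a, |a| ≤ R → |sampleMean (fun w => gaussKernel h (e w - a)) z -
      ∫ w, gaussKernel h (e w - a) ∂ρ| ≤ t := by
    intro a ha
    have h1 := hdev (fun x => f x + a) ⟨f, hf, a, ha, rfl⟩
    have h2 : residualKernel h (fun x => f x + a) = fun w => gaussKernel h (e w - a) := by
      funext w
      simp only [residualKernel, e]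
      congr 1
      ring
    rwa [h2] at h1
  have hsymm : ∀ a b, gaussKernel h (a - b) = gaussKernel h (b - a) := fun a b => by
    rw [← gaussKernel_neg, neg_sub]
  let I : ℝ → ℝ := fun a => ∫ w, gaussKernel h (e w - a) ∂ρ
  -- `A w` averages over the sample and `I (e w)` over `ρ`, with the same shift `e w`. The mean of
  -- `A` under `ρ` is the intermediate quantity: both comparisons cost at most `t`.
  let A : X × ℝ → ℝ := fun w => sampleMean (fun v => gaussKernel h (e v - e w)) z
  have hV : informationError ρ h f = -∫ w, I (e w) ∂ρ := by
    simp only [informationError, I, e]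
    congr 2
    funext w
    congr 1
    funext v
    exact hsymm _ _
  have hVz : empiricalPotential h z f = (∑ i, A (z i)) / n := by
    simp only [empiricalPotential, A, sampleMean, e]
    rw [← Finset.sum_div, div_div, ← sq, one_div, mul_comm, ← div_eq_mul_inv]
    congr 1
    refine Finset.sum_congr rfl fun i _ => Finset.sum_congr rfl fun j _ => hsymm _ _
  have hkm : Measurable fun q : (X × ℝ) × X × ℝ => gaussKernel h (e q.2 - e q.1) :=
    (continuous_gaussKernel h).measurable.comp (by fun_prop)
  have hIm : Integrable (fun w => I (e w)) ρ := by
    have h1 : Integrable (fun q : (X × ℝ) × X × ℝ => gaussKernel h (e q.2 - e q.1))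
        (ρ.prod ρ) := integrable_of_abs_le hkm fun _ => abs_gaussKernel_le hh _
    exact h1.integral_prod_left
  have hki : ∀ a, Integrable (fun w => gaussKernel h (a - e w)) ρ := fun a =>
    integrable_of_abs_le ((continuous_gaussKernel h).measurable.comp (by fun_prop))
      fun _ => abs_gaussKernel_le hh _
  have hAi : Integrable A ρ := by
    simp only [A, sampleMean]
    exact (integrable_finsetSum _ fun i _ => hki (e (z i))).div_const _
  have hmid : ∫ w, A w ∂ρ = (∑ i, I (e (z i))) / n := by
    simp only [A, sampleMean, I]
    rw [integral_div, integral_finsetSum _ fun i _ => hki (e (z i))]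
    congr 1
    refine Finset.sum_congr rfl fun i _ => ?_
    congr 1
    funext w
    exact hsymm _ _
  have h1 : |empiricalPotential h z f - ∫ w, A w ∂ρ| ≤ t := by
    rw [hVz, hmid, ← sub_div, ← Finset.sum_sub_distrib, abs_div, Nat.abs_cast, div_le_iff₀ hn']
    refine (Finset.abs_sum_le_sum_abs _ _).trans ?_
    refine (Finset.sum_le_sum fun i _ => hdev' _ (hz i)).trans ?_
    simp [mul_comm]
  have h2 : |∫ w, A w ∂ρ - ∫ w, I (e w) ∂ρ| ≤ t := by
    rw [← integral_sub hAi hIm]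
    have := norm_integral_le_of_norm_le_const (μ := ρ) (f := fun w => A w - I (e w)) (C := t) (by
      filter_upwards [hae] with w hw
      exact hdev' _ hw)
    simpa using this
  rw [hV]
  calc _ = |(empiricalPotential h z f - ∫ w, A w ∂ρ) + (∫ w, A w ∂ρ - ∫ w, I (e w) ∂ρ)| := by
        congr 1; ring
    _ ≤ _ := abs_add_le _ _
    _ ≤ _ := by linarith

-- Positivity of the potential allows the logarithm to be removed by monotonicity.
omit [MetricSpace X] [MeasurableSpace X] [BorelSpace X] in
lemma IsMEEOutput.empiricalPotential_le (hh : 0 < h) {n : ℕ} (hn : 1 ≤ n) {z : Fin n → X × ℝ}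
    {f g : X → ℝ} (hf : IsMEEOutput H h z f) (hg : g ∈ H) :
    empiricalPotential h z g ≤ empiricalPotential h z f := by
  have h1 : -Real.log (empiricalPotential h z f) ≤ -Real.log (empiricalPotential h z g) :=
    hf.2 g hg
  exact (Real.log_le_log_iff (empiricalPotential_pos hh hn z g)
    (empiricalPotential_pos hh hn z f)).1 (neg_le_neg_iff.1 h1)

/-- The learning rate `n ^ (-1/2)` of the MEE estimator, with confidence. -/
theorem exists_learning_rate
    (hsep : ∃ S : Set X, TopologicalSpace.IsSeparable S ∧ ∀ᵐ x ∂ρ.fst, x ∈ S)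
    {fstar : X → ℝ} {p : X → ℝ → ℝ} {M Mt : ℝ} (hM : 0 < M)
    (hmodel : ModelAdmissible ρ fstar p M) (hH : HypothesisAdmissible ρ fstar H M)
    (hP2 : SymmetricBoundedNoise p Mt) (hh : 2 * Mt < h) :
    ∃ C : ℝ, 0 < C ∧ ∀ n : ℕ, 1 ≤ n → ∀ fz : (Fin n → X × ℝ) → X → ℝ,
      (∀ᵐ z ∂(Measure.pi fun _ : Fin n => ρ), IsMEEOutput H h z (fz z)) →
      ∀ δ : ℝ, 0 < δ → δ < 1 →
        (Measure.pi fun _ : Fin n => ρ)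
          {z | C * √(Real.log (2 / δ)) * (n : ℝ) ^ (-(1 / 2) : ℝ) <
            adjustedErrorSq ρ.fst fstar (fz z)} ≤ ENNReal.ofReal δ := by
  have hMt := hP2.1
  have hh0 : 0 < h := by linarith
  have hfs := hmodel.measurable_fstar
  obtain ⟨c, s, hc, -, hs, hcov⟩ := hH.covering
  -- The shifts are residuals, bounded almost surely by `|f* - f| + Mt ≤ 2 M + Mt`.
  obtain ⟨κ, hκ, hdev⟩ := exists_measure_uniform_deviation_le hsep ⟨fstar, hH.fstar_mem⟩
    hH.continuous hc hs hcov hh0 (R := 2 * M + Mt) (by linarith)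
  obtain ⟨β, hβ, hcal⟩ := exists_adjustedErrorSq_le hMt hh hfs hmodel.density hP2
    hmodel.fstar_bounded
  -- Deviations of `2 t` at `fz` and at `f*` give excess error at most `4 t`. The factor `80 = 16 *
  -- 5` makes the tail `2 * exp (2 - 5 * ℓ)`, which is at most `2 * exp (-ℓ) = δ` because `ℓ ≥ 1 /
  -- 2`.
  refine ⟨4 * √(80 * κ) / β, by positivity, fun n hn fz hfz δ hδ0 hδ1 => ?_⟩
  have hn' : (0 : ℝ) < n := by exact_mod_cast hn
  set ℓ := Real.log (2 / δ) with hℓ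
  have hℓ1 : 1 / 2 ≤ ℓ := by
    have h1 : Real.log 2 ≤ ℓ := by
      refine Real.log_le_log (by norm_num) ?_
      rw [le_div_iff₀ hδ0]
      linarith
    linarith [Real.log_two_gt_d9]
  set t := √(80 * κ) * √ℓ * (n : ℝ) ^ (-(1 / 2) : ℝ) with ht
  have ht0 : 0 ≤ t := by positivity
  have hnpow : ((n : ℝ) ^ (-(1 / 2) : ℝ)) ^ 2 = (n : ℝ)⁻¹ := by
    rw [← Real.rpow_natCast, ← Real.rpow_mul hn'.le, ← Real.rpow_neg_one]
    norm_num
  have ht2 : t ^ 2 * n / (16 * κ) = 5 * ℓ := by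
    rw [ht, mul_pow, mul_pow, Real.sq_sqrt (by positivity), Real.sq_sqrt (by linarith), hnpow]
    field_simp
    norm_num
  have hnoise := hmodel.density.ae_abs_sub_le hfs hP2.2.2
  have hres : ∀ f ∈ H, ∀ w : X × ℝ, |w.2 - fstar w.1| ≤ Mt → |w.2 - f w.1| ≤ 2 * M + Mt := by
    intro f hf w hw
    have h1 := abs_le.1 hw
    have h2 := abs_le.1 (hH.bounded f hf w.1)
    have h3 := abs_le.1 (hmodel.fstar_bounded w.1)
    exact abs_le.2 ⟨by linarith, by linarith⟩
  have hnoise_z : ∀ᵐ z ∂(Measure.pi fun _ : Fin n => ρ),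
      ∀ i, |(z i).2 - fstar (z i).1| ≤ Mt := by
    rw [ae_all_iff]
    exact fun i =>
      (measurePreserving_eval (fun _ : Fin n => ρ) i).quasiMeasurePreserving.ae hnoise
  calc (Measure.pi fun _ : Fin n => ρ) {z | 4 * √(80 * κ) / β * √ℓ * (n : ℝ) ^ (-(1 / 2) : ℝ) <
          adjustedErrorSq ρ.fst fstar (fz z)}
      ≤ (Measure.pi fun _ : Fin n => ρ) {z | ∃ u ∈ translates H (2 * M + Mt),
        t < |sampleMean (residualKernel h u) z - ∫ w, residualKernel h u w ∂ρ|} := by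
        refine measure_mono_ae ?_
        filter_upwards [hfz, hnoise_z] with z hout hz hlt
        change ∃ u ∈ translates H (2 * M + Mt),
          t < |sampleMean (residualKernel h u) z - ∫ w, residualKernel h u w ∂ρ|
        by_contra! hcon
        have hpot : ∀ f ∈ H, |empiricalPotential h z f + informationError ρ h f| ≤ 2 * t :=
          fun f hf => abs_empiricalPotential_add_informationError_le hh0 hn hf
            (hH.continuous f hf).measurable (hnoise.mono fun w hw => hres f hf w hw)
            (fun i => hres f hf _ (hz i)) hcon
        have h1 := abs_le.1 (hpot _ hout.1)
        have h2 := abs_le.1 (hpot _ hH.fstar_mem)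
        have h3 := hout.empiricalPotential_le hh0 hn hH.fstar_mem
        have h4 := hcal _ (hH.continuous _ hout.1).measurable (hH.bounded _ hout.1)
        have h5 : 4 * t < β * adjustedErrorSq ρ.fst fstar (fz z) := by
          have h6 : 4 * √(80 * κ) / β * √ℓ * (n : ℝ) ^ (-(1 / 2) : ℝ) <
            adjustedErrorSq ρ.fst fstar (fz z) := hlt
          have h7 : 4 * √(80 * κ) / β * √ℓ * (n : ℝ) ^ (-(1 / 2) : ℝ) = 4 * t / β := by
            rw [ht]; ring
          rw [h7, div_lt_iff₀ hβ] at h6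
          linarith
        linarith
    _ ≤ ENNReal.ofReal (2 * Real.exp (2 - t ^ 2 * n / (16 * κ))) := hdev n hn t ht0
    _ ≤ ENNReal.ofReal δ := by
        refine ENNReal.ofReal_le_ofReal ?_
        rw [ht2]
        have h1 : Real.exp (2 - 5 * ℓ) ≤ Real.exp (-ℓ) := Real.exp_le_exp.2 (by linarith)
        have h2 : Real.exp (-ℓ) = δ / 2 := by
          rw [Real.exp_neg, hℓ, Real.exp_log (by positivity), inv_div]
        linarith

end Deviation

end MEE

theorem mainTheorem6 {X : Type*} [MetricSpace X] [MeasurableSpace X] [BorelSpace X]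
    (ρ : Measure (X × ℝ)) [IsProbabilityMeasure ρ]
    (hsep : ∃ S : Set X, TopologicalSpace.IsSeparable S ∧ ∀ᵐ x ∂ρ.fst, x ∈ S)
    (fstar : X → ℝ) (p : X → ℝ → ℝ) (H : Set (X → ℝ)) (M Mt : ℝ) (hM : 0 < M)
    (hmodel : MEE.ModelAdmissible ρ fstar p M)
    (hH : MEE.HypothesisAdmissible ρ fstar H M)
    (hP2 : MEE.SymmetricBoundedNoise p Mt)
    (h : ℝ) (hh : 4 * M + 2 * Mt < h) :
    (∀ b : ℝ, IsMinOn (MEE.informationError ρ h) {f | Measurable f} (fun x => fstar x + b)) ∧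
    (∀ fz : (n : ℕ) → (Fin n → X × ℝ) → X → ℝ,
      (∀ n, 1 ≤ n → ∀ᵐ z ∂(Measure.pi fun _ : Fin n => ρ), MEE.IsMEEOutput H h z (fz n z)) →
      ∀ ε : ℝ, 0 < ε →
        Tendsto (fun n : ℕ => (Measure.pi fun _ : Fin n => ρ)
          {z | ε < MEE.adjustedErrorSq ρ.fst fstar (fz n z)}) atTop (𝓝 0)) ∧
    (∃ C : ℝ, 0 < C ∧
      ∀ n : ℕ, 1 ≤ n → ∀ fz : (Fin n → X × ℝ) → X → ℝ,
        (∀ᵐ z ∂(Measure.pi fun _ : Fin n => ρ), MEE.IsMEEOutput H h z (fz z)) →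
        ∀ δ : ℝ, 0 < δ → δ < 1 →
          (Measure.pi fun _ : Fin n => ρ)
            {z | C * √(Real.log (2 / δ)) * (n : ℝ) ^ (-(1 / 2) : ℝ) <
              MEE.adjustedErrorSq ρ.fst fstar (fz z)} ≤ ENNReal.ofReal δ) := by
  have hrate := MEE.exists_learning_rate hsep hM hmodel hH hP2 (h := h) (by linarith)
  refine ⟨MEE.isMinOn_informationError hP2.1 (by linarith) hmodel.measurable_fstar hmodel.density
    hP2, fun fz hfz ε hε => ?_, hrate⟩
  obtain ⟨C, hC, hrate⟩ := hrate
  rw [ENNReal.tendsto_atTop_zero]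
  intro η hη
  -- Consistency follows from the rate: the confidence `δ` is fixed below `η`, and the threshold
  -- then falls below `ε` for large `n`.
  obtain ⟨δ, hδ0, hδ1, hδη⟩ : ∃ δ : ℝ, 0 < δ ∧ δ < 1 ∧ ENNReal.ofReal δ ≤ η := by
    rcases eq_or_ne η ⊤ with rfl | htop
    · exact ⟨1 / 2, by norm_num, by norm_num, le_top⟩
    · have h0 : 0 < η.toReal := ENNReal.toReal_pos hη.ne' htop
      refine ⟨min η.toReal (1 / 2), by positivity, (min_le_right _ _).trans_lt (by norm_num), ?_⟩
      exact (ENNReal.ofReal_le_ofReal (min_le_left _ _)).trans (ENNReal.ofReal_toReal htop).le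
  have hlim : Tendsto (fun n : ℕ => C * √(Real.log (2 / δ)) * (n : ℝ) ^ (-(1 / 2) : ℝ)) atTop
      (𝓝 0) := by
    have := ((tendsto_rpow_neg_atTop (show (0 : ℝ) < 1 / 2 by norm_num)).comp
      tendsto_natCast_atTop_atTop).const_mul (C * √(Real.log (2 / δ)))
    simpa only [mul_zero, Function.comp_apply] using this
  obtain ⟨N, hN⟩ := eventually_atTop.1 (hlim.eventually (gt_mem_nhds hε))
  refine ⟨max N 1, fun n hn => ?_⟩
  have hn1 : 1 ≤ n := (le_max_right _ _).trans hn
  refine le_trans (measure_mono fun z hz => ?_)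
    ((hrate n hn1 (fz n) (hfz n hn1) δ hδ0 hδ1).trans hδη)
  exact (hN n ((le_max_left _ _).trans hn)).trans hz
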